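/- There exist absolute constants $C, c, c', K > 0$ such that the following holds. Let $p, r, n \ge 1$ be integers, let $A \in \mathbb{R}^{p\times r}$ satisfy $A^T A = I_r$, let $\theta \in (0, 1/9]$, $\sigma > 0$ and $c_\star \in (0, 1/4]$, and suppose that $$ n \;\ge\; C \max\Big\{ \frac{r^2}{c_\star},\ \log^2 n \Big\}\, \frac{r \log n}{\theta c_\star}. $$ Let $X \in \mathbb{R}^{r\times n}$ be a random matrix with entries $X_{ij} = B_{ij} Z_{ij}$, where $B_{ij} \sim \mathrm{Ber}(\theta)$ and $Z_{ij} \sim \mathcal{N}(0, \sigma^2)$ for $1 \le i \le r$, $1 \le j \le n$, all these variables being jointly independent. Put $Y = AX$ and $$ F(q) = -\frac{1}{12\,\theta \sigma^4 n}\, \| Y^T q \|_4^4, \qquad q \in \mathbb{S}^{p-1} = \{ q \in \mathbb{R}^p : \|q\|_2 = 1\}. $$ Then, with probability at least $1 - c\, n^{-c'}$, every local minimizer $\bar q$ of $F$ on $\mathbb{S}^{p-1}$ with $\|A^T \bar q\|_\infty^2 > c_\star$ satisfies $$ \big\| \bar q - A P_{\cdot 1} \big\|_2^2 \;\le\; K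 \left( \sqrt{\frac{r^2 \log n}{\theta n}} + \Big( \theta r^2 + \frac{\log^2 n}{\theta} \Big) \frac{r \log n}{n} \right) $$ for some signed permutation matrix $P \in \mathbb{R}^{r\times r}$ (possibly depending on $\bar q$), where $P_{\cdot 1}$ is the first column of $P$. -/

import Mathlib

open MeasureTheory ProbabilityTheory
open scoped Matrix

namespace SparseDecomposition

/-- The Bernoulli-Gaussian model for a random `r × n` matrix `X`: its entries are
`X i j = B i j * Z i j` with `B i j` distributed as `Ber(θ)` on `{0, 1}` (success value `1`),
`Z i j` distributed as `N(0, σ²)`, and all the variables `B i j`, `Z i j` jointly independent. -/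
def IsBernoulliGaussian {Ω : Type*} [MeasurableSpace Ω] (μ : Measure Ω) {r n : ℕ}
    (θ : unitInterval) (σ : ℝ) (X : Ω → Matrix (Fin r) (Fin n) ℝ) : Prop :=
  ∃ B Z : Fin r → Fin n → Ω → ℝ,
    (∀ i j, HasLaw (B i j) (bernoulliMeasure (1 : ℝ) 0 θ) μ) ∧
    (∀ i j, HasLaw (Z i j) (gaussianReal 0 (Real.toNNReal (σ ^ 2))) μ) ∧
    iIndepFun (fun k : (Fin r × Fin n) ⊕ (Fin r × Fin n) =>
      Sum.elim (fun e => B e.1 e.2) (fun e => Z e.1 e.2) k) μ ∧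
    ∀ ω i j, X ω i j = B i j ω * Z i j ω

/-- The finite-sample objective `F(q) = -‖Yᵀ q‖₄⁴ / (12 θ σ⁴ n)`, for a data matrix `Y`
with `n` columns. -/
noncomputable def objective {p n : ℕ} (θ σ : ℝ) (Y : Matrix (Fin p) (Fin n) ℝ)
    (q : EuclideanSpace ℝ (Fin p)) : ℝ :=
  -(1 / (12 * θ * σ ^ 4 * n)) * ∑ k, |(Yᵀ *ᵥ q.ofLp) k| ^ 4

/-- A local solution of the problem: minimize `F(q)` subject to `‖q‖₂ = 1`. -/
def IsLocalSolution {p n : ℕ} (θ σ : ℝ) (Y : Matrix (Fin p) (Fin n) ℝ)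
    (q : EuclideanSpace ℝ (Fin p)) : Prop :=
  q ∈ Metric.sphere (0 : EuclideanSpace ℝ (Fin p)) 1 ∧
    IsLocalMinOn (objective θ σ Y) (Metric.sphere (0 : EuclideanSpace ℝ (Fin p)) 1) q

/-- The region of the unit sphere on which `‖Aᵀ q‖_∞² ≤ c` (the norm of `Fin r → ℝ` is the
sup norm). -/
def nullRegion {p r : ℕ} (A : Matrix (Fin p) (Fin r) ℝ) (c : ℝ) :
    Set (EuclideanSpace ℝ (Fin p)) :=
  {q | q ∈ Metric.sphere (0 : EuclideanSpace ℝ (Fin p)) 1 ∧ ‖Aᵀ *ᵥ q.ofLp‖ ^ 2 ≤ c}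

/-- Signed permutation matrices: column `j` is `s j` times the standard basis vector `e_(π j)`,
for a permutation `π` and signs `s j`. -/
def IsSignedPermutation {r : ℕ} (P : Matrix (Fin r) (Fin r) ℝ) : Prop :=
  ∃ (π : Equiv.Perm (Fin r)) (s : Fin r → ℝ), (∀ j, s j = 1 ∨ s j = -1) ∧
    ∀ i j, P i j = if i = π j then s j else 0

end SparseDecomposition

namespace SparseDecomposition

/-! Write `u = Aᵀ q` and let `x k` be the columns of `X / σ`. Up to a negative constant, the
objective is the empirical quartic form `∑ k, ⟨x k, u⟩⁴`. After normalization by `1 / (3 θ n)` its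
expectation is `(1 - θ) ‖u‖₄⁴ + θ ‖u‖₂⁴`, whose maximizers on the unit sphere are the signed basis
vectors.

Deterministic half. Suppose the empirical and population forms differ by at most `δ ‖a‖₂⁴` for every
`a`. Restricted to a plane, a uniformly small binary quartic has small coefficients
(`abs_coefficients_le_of_abs_quartic_le`), so gradients and Hessians are close as well and need no
separate concentration argument. At a local minimizer it then suffices to test one tangent
direction, the one pointing to the basis vector `e i` of the largest coordinate of `u`
(`one_sub_sq_le_of_second_order`). The second-order condition forces `u i ^ 2 ≥ 3/5`, provided `δ`
is small compared with `u i ^ 2`; this is where exclusion of the null region enters. The first-order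
condition then gives `1 - u i ^ 2 = O(δ)`. Tangent vectors in the span of `q` and the range of `A`
also show that `q` lies in that range (`exists_signedPermutation_near_of_isLocalSolution`).

Probabilistic half (`exists_uniform_quartic_deviation`). The quartics are truncated where `‖x k‖²`
is large. Bernstein's inequality is applied at each point of a fine grid, and a union bound together
with a Lipschitz estimate covers the sphere. Eighth moments and an exponential tail of `‖x k‖²`
control the truncation bias. Homogeneity extends the bound to all vectors, with `δ` a multiple of
`errorRate`; the sample-size assumption makes `δ ≤ cs / 45`. -/

/-! ### Moments of the standard Gaussian -/

theorem integrable_pow_gaussianReal (k : ℕ) :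
    Integrable (fun x : ℝ => x ^ k) (gaussianReal 0 1) := by
  have h := (memLp_id_gaussianReal (μ := 0) (v := 1) (k : NNReal)).integrable_norm_pow' 
  refine (integrable_norm_iff (by fun_prop)).1 ?_
  simpa [norm_pow] using h

theorem integrable_pow_mul_gaussianPDFReal (k : ℕ) :
    Integrable (fun x : ℝ => x ^ k * gaussianPDFReal 0 1 x) := by
  have h := integrable_pow_gaussianReal k
  rw [gaussianReal_of_var_ne_zero _ one_ne_zero,
    integrable_withDensity_iff (measurable_gaussianPDF _ _)
      (ae_of_all _ fun _ => gaussianPDF_lt_top)] at h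
  simpa using h

theorem hasDerivAt_gaussianPDFReal_std (x : ℝ) :
    HasDerivAt (gaussianPDFReal 0 1) (-(x * gaussianPDFReal 0 1 x)) x := by
  have h : HasDerivAt (fun x : ℝ => (√(2 * Real.pi * (1 : NNReal)))⁻¹ *
      Real.exp (-(x - 0) ^ 2 / (2 * (1 : NNReal)))) _ x :=
    (((((hasDerivAt_id x).sub_const 0).pow 2).neg.div_const _).exp).const_mul _
  rw [gaussianPDFReal_def]
  convert h using 1
  simp
  ring

/-- Integration by parts, since the density satisfies `φ' = -x φ`. -/
theorem integral_pow_add_two_gaussianReal (k : ℕ) :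
    ∫ x : ℝ, x ^ (k + 2) ∂(gaussianReal 0 1) = (k + 1) * ∫ x : ℝ, x ^ k ∂(gaussianReal 0 1) := by
  rw [integral_gaussianReal_eq_integral_smul one_ne_zero,
    integral_gaussianReal_eq_integral_smul one_ne_zero]
  have h := integral_mul_deriv_eq_deriv_mul_of_integrable
    (u := fun x : ℝ => x ^ (k + 1)) (u' := fun x => ((k + 1 : ℕ) : ℝ) * x ^ k)
    (v := gaussianPDFReal 0 1) (v' := fun x => -(x * gaussianPDFReal 0 1 x))
    (fun x _ => by simpa using hasDerivAt_pow (k + 1) x)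
    (fun x _ => hasDerivAt_gaussianPDFReal_std x)
    (by
      refine ((integrable_pow_mul_gaussianPDFReal (k + 2)).neg).congr (ae_of_all _ fun x => ?_)
      simp only [Pi.neg_apply, Pi.mul_apply]; ring)
    (by
      refine ((integrable_pow_mul_gaussianPDFReal k).const_mul ((k + 1 : ℕ) : ℝ)).congr
        (ae_of_all _ fun x => ?_)
      simp only [Pi.mul_apply]; ring)
    (integrable_pow_mul_gaussianPDFReal (k + 1))
  rw [← integral_const_mul]
  have e1 : ∫ x : ℝ, gaussianPDFReal 0 1 x • x ^ (k + 2) =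
      -∫ x : ℝ, x ^ (k + 1) * -(x * gaussianPDFReal 0 1 x) := by
    rw [← integral_neg]
    congr 1; ext x; simp only [smul_eq_mul]; ring
  rw [e1, h, neg_neg]
  congr 1; ext x; simp only [smul_eq_mul]; push_cast; ring

theorem integral_pow_gaussianReal_odd (k : ℕ) :
    ∫ x : ℝ, x ^ (2 * k + 1) ∂(gaussianReal 0 1) = 0 := by
  induction k with
  | zero => simp [integral_id_gaussianReal]
  | succ k ih =>
    rw [show 2 * (k + 1) + 1 = (2 * k + 1) + 2 by ring, integral_pow_add_two_gaussianReal, ih,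
      mul_zero]

theorem gaussianReal_exp_sq :
    Integrable (fun x : ℝ => Real.exp (x ^ 2 / 4)) (gaussianReal 0 1) ∧
      ∫ x : ℝ, Real.exp (x ^ 2 / 4) ∂(gaussianReal 0 1) = √2 := by
  have e : ∀ x : ℝ, gaussianPDFReal 0 1 x * Real.exp (x ^ 2 / 4) =
      (√(2 * Real.pi))⁻¹ * Real.exp (-(1 / 4) * x ^ 2) := by
    intro x
    simp only [gaussianPDFReal, NNReal.coe_one, mul_one, sub_zero]
    rw [mul_assoc, ← Real.exp_add]
    congr 2; ring
  constructor
  · rw [gaussianReal_of_var_ne_zero _ one_ne_zero,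
      integrable_withDensity_iff (measurable_gaussianPDF _ _)
        (ae_of_all _ fun _ => gaussianPDF_lt_top)]
    refine ((integrable_exp_neg_mul_sq (b := 1 / 4) (by norm_num)).const_mul
      ((√(2 * Real.pi))⁻¹)).congr (ae_of_all _ fun x => ?_)
    simp only [toReal_gaussianPDF]
    rw [← e x, mul_comm]
  · rw [integral_gaussianReal_eq_integral_smul one_ne_zero]
    simp only [smul_eq_mul, e]
    rw [integral_const_mul, integral_gaussian, ← Real.sqrt_inv, ← Real.sqrt_mul (by positivity)]
    congr 1
    have := Real.pi_pos
    field_simp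
    norm_num

/-! ### Bernoulli-Gaussian products and grouping of independent families -/

/-- Almost surely `B` is 0 or 1, so `g (B Z) = g 0 + B (g Z - g 0)`, and independence factors the
expectation of the product. -/
theorem integral_comp_bernoulli_mul_gaussian {Ω : Type*} [MeasurableSpace Ω] {μ : Measure Ω}
    [IsProbabilityMeasure μ] {θ : unitInterval} {B Z : Ω → ℝ}
    (hB : HasLaw B (bernoulliMeasure (1 : ℝ) 0 θ) μ) (hZ : HasLaw Z (gaussianReal 0 1) μ)
    (hBZ : IndepFun B Z μ) {g : ℝ → ℝ} (hg : Measurable g)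
    (hgi : Integrable g (gaussianReal 0 1)) :
    Integrable (fun ω => g (B ω * Z ω)) μ ∧
      ∫ ω, g (B ω * Z ω) ∂μ = (1 - θ) * g 0 + θ * ∫ x, g x ∂(gaussianReal 0 1) := by
  have hB01 : ∀ᵐ ω ∂μ, B ω = 1 ∨ B ω = 0 := by
    have : Measurable fun x : ℝ => x = 1 ∨ x = 0 :=
      measurableSet_setOfPred.1 ((measurableSet_singleton (1 : ℝ)).union (measurableSet_singleton 0))
    rw [hB.ae_iff this]
    simp [bernoulliMeasure_def, ae_add_measure_iff]
    constructor <;> refine Measure.ae_smul_measure ?_ _ <;> simp [ae_dirac_eq]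
  have hae : (fun ω => g 0 + B ω * (g (Z ω) - g 0)) =ᵐ[μ] fun ω => g (B ω * Z ω) := by
    filter_upwards [hB01] with ω h
    rcases h with h | h <;> simp [h]
  have hBi : Integrable B μ := by
    refine (integrable_const (1 : ℝ)).mono' hB.aemeasurable.aestronglyMeasurable ?_
    filter_upwards [hB01] with ω h
    rcases h with h | h <;> simp [h]
  have hgZ : Integrable (fun ω => g (Z ω)) μ := by
    have := hgi
    rw [← hZ.map_eq] at this
    exact this.comp_aemeasurable hZ.aemeasurable
  have hgZ' : Integrable (fun ω => g (Z ω) - g 0) μ := hgZ.sub (integrable_const _)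
  have hind : IndepFun B (fun ω => g (Z ω) - g 0) μ :=
    hBZ.comp (φ := id) (ψ := fun z => g z - g 0) measurable_id (hg.sub_const _)
  have hprod : Integrable (fun ω => B ω * (g (Z ω) - g 0)) μ := hind.integrable_mul hBi hgZ'
  have hEB : ∫ ω, B ω ∂μ = θ := by
    rw [hB.integral_eq, integral_bernoulliMeasure]; simp
  have hEg : ∫ ω, g (Z ω) ∂μ = ∫ x, g x ∂(gaussianReal 0 1) :=
    hZ.integral_comp hg.aestronglyMeasurable
  refine ⟨((integrable_const (g 0)).add hprod).congr hae, ?_⟩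
  rw [← integral_congr_ae hae, integral_add (integrable_const _) hprod,
    hind.integral_fun_mul_eq_mul_integral hBi.aestronglyMeasurable hgZ'.aestronglyMeasurable,
    integral_sub hgZ (integrable_const _), hEB, hEg]
  simp
  ring

/-- Independence says that the joint law is a product measure, and currying sends a product over `ι
× κ` to an iterated product. -/
theorem iIndepFun_curry {Ω ι κ : Type*} [MeasurableSpace Ω] {μ : Measure Ω} [Countable ι]
    [Countable κ] {f : ι × κ → Ω → ℝ} (hm : ∀ e, AEMeasurable (f e) μ) (h : iIndepFun f μ) :
    iIndepFun (fun i ω j => f (i, j) ω) μ := by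
  have := h.isProbabilityMeasure
  have : ∀ e, IsProbabilityMeasure (μ.map (f e)) := fun e => Measure.isProbabilityMeasure_map (hm e)
  have hcol : ∀ i, iIndepFun (fun j => f (i, j)) μ := fun i =>
    h.precomp (g := fun j => (i, j)) (fun a b hab => by simpa using hab)
  rw [iIndepFun_iff_map_fun_eq_infinitePi_map₀' (fun i => aemeasurable_pi_lambda _ fun j => hm _)]
  have e1 := h.map_fun_eq_infinitePi_map₀' hm
  have e2 : (MeasurableEquiv.curry ι κ ℝ) ∘ (fun ω e => f e ω) = fun ω i j => f (i, j) ω := rfl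
  rw [← e2, ← AEMeasurable.map_map_of_aemeasurable (by fun_prop)
    (aemeasurable_pi_lambda _ fun e => hm e), e1]
  have := Measure.infinitePi_map_curry (fun i j => μ.map (f (i, j)))
  refine Eq.trans ?_ (this.trans ?_)
  · rfl
  · congr 1; ext1 i
    exact ((hcol i).map_fun_eq_infinitePi_map₀' fun j => hm _).symm

/-- `X` is distributed as the product of a `Ber(θ)` and an independent `N(0, 1)` variable,
expressed through the expectations of test functions. -/
def IsSparseGaussian {Ω : Type*} [MeasurableSpace Ω] (μ : Measure Ω) (θ : ℝ) (X : Ω → ℝ) : Prop :=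
  AEMeasurable X μ ∧ ∀ g : ℝ → ℝ, Measurable g → Integrable g (gaussianReal 0 1) →
    Integrable (fun ω => g (X ω)) μ ∧
      ∫ ω, g (X ω) ∂μ = (1 - θ) * g 0 + θ * ∫ x, g x ∂(gaussianReal 0 1)

/-! ### Moments of linear forms, tail of the squared norm, Bernstein's inequality -/

section Moments

variable {Ω : Type*} [MeasurableSpace Ω] {μ : Measure Ω} {θ : ℝ}

theorem IsSparseGaussian.integrable_pow {X : Ω → ℝ} (h : IsSparseGaussian μ θ X) (k : ℕ) :
    Integrable (fun ω => X ω ^ k) μ :=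
  (h.2 (fun x => x ^ k) (by fun_prop) (integrable_pow_gaussianReal k)).1

theorem IsSparseGaussian.integral_pow_odd {X : Ω → ℝ} (h : IsSparseGaussian μ θ X) (k : ℕ) :
    ∫ ω, X ω ^ (2 * k + 1) ∂μ = 0 := by
  rw [(h.2 (fun x => x ^ (2 * k + 1)) (by fun_prop) (integrable_pow_gaussianReal _)).2,
    integral_pow_gaussianReal_odd]
  simp

theorem IsSparseGaussian.integral_pow_even {X : Ω → ℝ} (h : IsSparseGaussian μ θ X) :
    ∫ ω, X ω ^ 2 ∂μ = θ ∧ ∫ ω, X ω ^ 4 ∂μ = 3 * θ ∧ ∫ ω, X ω ^ 6 ∂μ = 15 * θ ∧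
      ∫ ω, X ω ^ 8 ∂μ = 105 * θ := by
  have h2 : ∫ x : ℝ, x ^ 2 ∂(gaussianReal 0 1) = 1 := by
    rw [integral_pow_add_two_gaussianReal 0]; simp
  have h4 : ∫ x : ℝ, x ^ 4 ∂(gaussianReal 0 1) = 3 := by
    rw [integral_pow_add_two_gaussianReal 2, h2]; norm_num
  have h6 : ∫ x : ℝ, x ^ 6 ∂(gaussianReal 0 1) = 15 := by
    rw [integral_pow_add_two_gaussianReal 4, h4]; norm_num
  have h8 : ∫ x : ℝ, x ^ 8 ∂(gaussianReal 0 1) = 105 := by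
    rw [integral_pow_add_two_gaussianReal 6, h6]; norm_num
  have key : ∀ k : ℕ, ∫ ω, X ω ^ k ∂μ =
      (1 - θ) * 0 ^ k + θ * ∫ x : ℝ, x ^ k ∂(gaussianReal 0 1) := fun k =>
    (h.2 (fun x => x ^ k) (by fun_prop) (integrable_pow_gaussianReal k)).2
  refine ⟨?_, ?_, ?_, ?_⟩
  · rw [key, h2]; ring
  · rw [key, h4]; ring
  · rw [key, h6]; ring
  · rw [key, h8]; ring

theorem integral_add_pow_of_indepFun {S Y : Ω → ℝ} (hSY : IndepFun S Y μ)
    (hS : ∀ k : ℕ, Integrable (fun ω => S ω ^ k) μ)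
    (hY : ∀ k : ℕ, Integrable (fun ω => Y ω ^ k) μ) (m : ℕ) :
    Integrable (fun ω => (S ω + Y ω) ^ m) μ ∧
      ∫ ω, (S ω + Y ω) ^ m ∂μ = ∑ k ∈ Finset.range (m + 1),
        (∫ ω, S ω ^ k ∂μ) * (∫ ω, Y ω ^ (m - k) ∂μ) * (m.choose k) := by
  have hind : ∀ k l : ℕ, IndepFun (fun ω => S ω ^ k) (fun ω => Y ω ^ l) μ := fun k l =>
    hSY.comp (φ := fun x => x ^ k) (ψ := fun x => x ^ l) (by fun_prop) (by fun_prop)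
  have hi : ∀ k l : ℕ, Integrable (fun ω => S ω ^ k * Y ω ^ l) μ := fun k l =>
    (hind k l).integrable_mul (hS k) (hY l)
  simp_rw [add_pow]
  refine ⟨integrable_finsetSum _ fun k _ => (hi _ _).mul_const _, ?_⟩
  rw [integral_finsetSum _ fun k _ => (hi _ _).mul_const _]
  refine Finset.sum_congr rfl fun k _ => ?_
  rw [integral_mul_const, (hind _ _).integral_fun_mul_eq_mul_integral
    (hS k).aestronglyMeasurable (hY _).aestronglyMeasurable]

theorem integrable_exp_mul_of_mgf_pos {X : Ω → ℝ} {t : ℝ} (h : 0 < mgf X μ t) :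
    Integrable (fun ω => Real.exp (t * X ω)) μ := by
  by_contra hc
  exact h.ne' (mgf_undef hc)

variable [IsProbabilityMeasure μ]

/-- Induction on the number of summands: in the binomial expansion the odd moments of the new term
vanish. Keeping a factor `θ` in the eighth moment matters, since it is the variance proxy that
produces the square-root term of the rate. -/
theorem moments_sum_sparseGaussian {ι : Type*} {X : ι → Ω → ℝ} (hθ0 : 0 ≤ θ) (hθ1 : θ ≤ 1)
    (hX : ∀ i, IsSparseGaussian μ θ (X i)) (hind : iIndepFun X μ) (w : ι → ℝ) (s : Finset ι) :
    (∀ k : ℕ, Integrable (fun ω => (∑ i ∈ s, X i ω * w i) ^ k) μ) ∧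
    ∫ ω, (∑ i ∈ s, X i ω * w i) ^ 2 ∂μ = θ * ∑ i ∈ s, w i ^ 2 ∧
    ∫ ω, (∑ i ∈ s, X i ω * w i) ^ 4 ∂μ =
      3 * θ * ((1 - θ) * ∑ i ∈ s, w i ^ 4 + θ * (∑ i ∈ s, w i ^ 2) ^ 2) ∧
    ∫ ω, (∑ i ∈ s, X i ω * w i) ^ 6 ∂μ ≤ 15 * θ * (∑ i ∈ s, w i ^ 2) ^ 3 ∧
    ∫ ω, (∑ i ∈ s, X i ω * w i) ^ 8 ∂μ ≤ 105 * θ * (∑ i ∈ s, w i ^ 2) ^ 4 := by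
  classical
  induction s using Finset.induction_on with
  | empty =>
    simp only [Finset.sum_empty]
    refine ⟨fun k => integrable_const _, ?_⟩
    simp
  | insert a s ha ih =>
    obtain ⟨hi, h2, h4, h6, h8⟩ := ih
    simp only [Finset.sum_insert ha]
    set Q := ∑ i ∈ s, w i ^ 2 with hQ
    have hQ0 : 0 ≤ Q := Finset.sum_nonneg fun i _ => sq_nonneg _
    have hYi : ∀ k : ℕ, Integrable (fun ω => (X a ω * w a) ^ k) μ := fun k => by
      simp_rw [mul_pow]; exact ((hX a).integrable_pow k).mul_const _
    have hSm : ∀ i, AEMeasurable (fun ω => X i ω * w i) μ := fun i => (hX i).1.mul_const _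
    have hindw : iIndepFun (fun i ω => X i ω * w i) μ :=
      hind.comp (fun i x => x * w i) fun i => by fun_prop
    have hSY : IndepFun (fun ω => ∑ i ∈ s, X i ω * w i) (fun ω => X a ω * w a) μ := by
      have := hindw.indepFun_finsetSum_of_notMem₀ hSm ha
      convert this using 1
      ext ω; simp
    have hb := integral_add_pow_of_indepFun hSY hi hYi
    have hYm : ∀ k : ℕ, ∫ ω, (X a ω * w a) ^ k ∂μ = (∫ ω, X a ω ^ k ∂μ) * w a ^ k := fun k => by
      simp_rw [mul_pow]; exact integral_mul_const _ _
    obtain ⟨y2, y4, y6, y8⟩ := (hX a).integral_pow_even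
    have y1 : ∫ ω, X a ω ∂μ = 0 := by simpa using (hX a).integral_pow_odd 0
    have y3 := (hX a).integral_pow_odd 1
    have y5 := (hX a).integral_pow_odd 2
    have y7 := (hX a).integral_pow_odd 3
    norm_num at y3 y5 y7
    have comm : ∀ ω, X a ω * w a + ∑ i ∈ s, X i ω * w i =
        (∑ i ∈ s, X i ω * w i) + X a ω * w a := fun ω => add_comm _ _
    simp_rw [comm]
    set v := w a ^ 2 with hv
    have hv0 : 0 ≤ v := sq_nonneg _
    have e4 : w a ^ 4 = v ^ 2 := by rw [hv]; ring
    have e6 : w a ^ 6 = v ^ 3 := by rw [hv]; ring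
    have e8 : w a ^ 8 = v ^ 4 := by rw [hv]; ring
    have h4' : ∫ ω, (∑ i ∈ s, X i ω * w i) ^ 4 ∂μ ≤ 3 * θ * Q ^ 2 := by
      rw [h4]
      have : ∑ i ∈ s, w i ^ 4 ≤ Q ^ 2 := by
        have := Finset.sum_sq_le_sq_sum_of_nonneg (s := s) (f := fun i => w i ^ 2)
          (fun i _ => sq_nonneg _)
        simpa [← pow_mul] using this
      have h1 : (1 - θ) * ∑ i ∈ s, w i ^ 4 ≤ (1 - θ) * Q ^ 2 :=
        mul_le_mul_of_nonneg_left this (by linarith)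
      have : 3 * θ * ((1 - θ) * ∑ i ∈ s, w i ^ 4 + θ * Q ^ 2) ≤
          3 * θ * ((1 - θ) * Q ^ 2 + θ * Q ^ 2) := by gcongr
      linarith
    refine ⟨fun k => (hb k).1, ?_, ?_, ?_, ?_⟩
    · rw [(hb 2).2]
      simp [Finset.sum_range_succ, hYm, y1, y2, h2, Nat.choose]
      ring
    · rw [(hb 4).2]
      simp [Finset.sum_range_succ, hYm, y1, y2, y3, y4, h2, h4, Nat.choose, e4]
      ring
    · rw [(hb 6).2]
      simp [Finset.sum_range_succ, hYm, y1, y2, y3, y4, y5, y6, h2, Nat.choose, e4, e6, ← hv]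
      -- The mixed terms carry `θ²`; dropping one factor `θ ≤ 1` completes the cube `15 θ (Q + v)³`.
      -- The eighth moment is handled likewise.
      have a1 : θ * Q * (3 * θ * v ^ 2) ≤ 1 * Q * (3 * θ * v ^ 2) := by gcongr
      have a2 : (∫ ω, (∑ i ∈ s, X i ω * w i) ^ 4 ∂μ) * (θ * v) ≤ 3 * 1 * Q ^ 2 * (θ * v) :=
        mul_le_mul_of_nonneg_right (h4'.trans (by gcongr)) (by positivity)
      nlinarith [a1, a2, h6]
    · rw [(hb 8).2]
      simp [Finset.sum_range_succ, hYm, y1, y2, y3, y4, y5, y6, y7, y8, h2, Nat.choose, e4, e6, e8,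
        ← hv]
      have a1 : θ * Q * (15 * θ * v ^ 3) ≤ 1 * Q * (15 * θ * v ^ 3) := by gcongr
      have a2 : (∫ ω, (∑ i ∈ s, X i ω * w i) ^ 4 ∂μ) * (3 * θ * v ^ 2) ≤
          3 * 1 * Q ^ 2 * (3 * θ * v ^ 2) :=
        mul_le_mul_of_nonneg_right (h4'.trans (by gcongr)) (by positivity)
      have a3 : (∫ ω, (∑ i ∈ s, X i ω * w i) ^ 6 ∂μ) * (θ * v) ≤ 15 * 1 * Q ^ 3 * (θ * v) :=
        mul_le_mul_of_nonneg_right (h6.trans (by gcongr)) (by positivity)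
      nlinarith [a1, a2, a3, h8]

/-- Chernoff bound at parameter `1/4`: each factor is `1 - θ + θ √2 ≤ 1 + θ / 2 ≤ exp (θ / 2)`. -/
theorem measure_sum_sq_ge_le {r : ℕ} {X : Fin r → Ω → ℝ} (hθ0 : 0 ≤ θ)
    (hX : ∀ i, IsSparseGaussian μ θ (X i)) (hind : iIndepFun X μ) (R : ℝ) :
    μ.real {ω | R ≤ ∑ i, X i ω ^ 2} ≤ Real.exp (θ * r / 2 - R / 4) := by
  have hm : ∀ i, AEMeasurable (fun ω => X i ω ^ 2) μ := fun i => (hX i).1.pow_const 2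
  have hind2 : iIndepFun (fun i ω => X i ω ^ 2) μ :=
    hind.comp (fun i x => x ^ 2) fun i => by fun_prop
  have hexp := fun i => (hX i).2 (fun x => Real.exp (x ^ 2 / 4)) (by fun_prop)
    gaussianReal_exp_sq.1
  have hi : ∀ i, Integrable (fun ω => Real.exp (1 / 4 * X i ω ^ 2)) μ := fun i => by
    refine (hexp i).1.congr (ae_of_all _ fun ω => ?_)
    simp only; congr 1; ring
  have hmgf : ∀ i, mgf (fun ω => X i ω ^ 2) μ (1 / 4) ≤ Real.exp (θ / 2) := fun i => by
    have : mgf (fun ω => X i ω ^ 2) μ (1 / 4) = ∫ ω, Real.exp (X i ω ^ 2 / 4) ∂μ := by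
      simp only [mgf]; congr 1; ext ω; congr 1; ring
    rw [this, (hexp i).2, gaussianReal_exp_sq.2]
    have h2 : √2 ≤ 3 / 2 := by rw [Real.sqrt_le_left (by norm_num)]; norm_num
    have := Real.add_one_le_exp (θ / 2)
    have := mul_le_mul_of_nonneg_left h2 hθ0
    simp
    linarith
  have hsum := hind2.mgf_sum₀ (t := 1 / 4) hm Finset.univ
  have hint : Integrable (fun ω => Real.exp (1 / 4 * (∑ i, fun ω => X i ω ^ 2) ω)) μ := by
    apply integrable_exp_mul_of_mgf_pos
    rw [hsum]
    exact Finset.prod_pos fun i _ => mgf_pos (hi i)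
  have := measure_ge_le_exp_mul_mgf (μ := μ) (X := ∑ i, fun ω => X i ω ^ 2) R
    (t := 1 / 4) (by norm_num) hint
  simp only [Finset.sum_apply] at this
  refine this.trans ?_
  rw [hsum]
  have : ∏ i, mgf (fun ω => X i ω ^ 2) μ (1 / 4) ≤ ∏ i : Fin r, Real.exp (θ / 2) :=
    Finset.prod_le_prod (fun i _ => mgf_nonneg) fun i _ => hmgf i
  refine (mul_le_mul_of_nonneg_left this (Real.exp_pos _).le).trans ?_
  rw [Finset.prod_const, ← Real.exp_nat_mul, ← Real.exp_add]
  apply le_of_eq; congr 1; simp; ring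

/-- Bernstein's inequality in its parametrized form, for variables with values in `[-M, M]`. -/
theorem bernstein_inequality {n : ℕ} {Y : Fin n → Ω → ℝ} (hm : ∀ k, AEMeasurable (Y k) μ)
    (hind : iIndepFun Y μ) {M V a L : ℝ} (hM : ∀ k ω, |Y k ω| ≤ M)
    (hV : ∀ k, ∫ ω, Y k ω ^ 2 ∂μ ≤ V)
    (ha : 0 < a) (haM : a * M ≤ 1) :
    μ.real {ω | n * (a * V) + L / a ≤ |∑ k, Y k ω - ∑ k, ∫ ω', Y k ω' ∂μ|} ≤ 2 * Real.exp (-L) := by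
  have hYi : ∀ k, Integrable (Y k) μ := fun k =>
    (integrable_const M).mono' (hm k).aestronglyMeasurable (ae_of_all _ fun ω => hM k ω)
  have hY2i : ∀ k, Integrable (fun ω => Y k ω ^ 2) μ := fun k =>
    (integrable_const (M ^ 2)).mono' ((hm k).pow_const 2).aestronglyMeasurable
      (ae_of_all _ fun ω => by
        rw [Real.norm_eq_abs, abs_pow]; exact pow_le_pow_left₀ (abs_nonneg _) (hM k ω) 2)
  have habs : ∀ t : ℝ, |t| = a → ∀ k ω, |t * Y k ω| ≤ 1 := fun t ht k ω => by
    rw [abs_mul, ht]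
    exact (mul_le_mul_of_nonneg_left (hM k ω) ha.le).trans haM
  have hexpi : ∀ t : ℝ, |t| = a → ∀ k, Integrable (fun ω => Real.exp (t * Y k ω)) μ :=
    fun t ht k => (integrable_const (Real.exp 1)).mono'
      ((hm k).const_mul t).exp.aestronglyMeasurable (ae_of_all _ fun ω => by
        rw [Real.norm_eq_abs, Real.abs_exp]
        exact Real.exp_le_exp.2 ((le_abs_self _).trans (habs t ht k ω)))
  have hmgf : ∀ t : ℝ, |t| = a → ∀ k, mgf (Y k) μ t ≤ Real.exp (t * (∫ ω, Y k ω ∂μ) + a ^ 2 * V) := by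
    intro t ht k
    have ht2 : t ^ 2 = a ^ 2 := by rw [← ht, sq_abs]
    -- Uses `exp y ≤ 1 + y + y²` for `|y| ≤ 1`, so the raw second moment can stand in for the
    -- variance.
    have h1 : mgf (Y k) μ t ≤ ∫ ω, (1 + t * Y k ω + t ^ 2 * Y k ω ^ 2) ∂μ := by
      refine integral_mono (hexpi t ht k)
        (((integrable_const _).add ((hYi k).const_mul t)).add ((hY2i k).const_mul _)) fun ω => ?_
      have := (abs_le.1 (Real.abs_exp_sub_one_sub_id_le (habs t ht k ω))).2
      simp only
      nlinarith [this]
    have h1' : ∫ ω, (1 + t * Y k ω + t ^ 2 * Y k ω ^ 2) ∂μ =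
        1 + t * (∫ ω, Y k ω ∂μ) + a ^ 2 * ∫ ω, Y k ω ^ 2 ∂μ := by
      have i1 : Integrable (fun ω => t * Y k ω) μ := (hYi k).const_mul t
      have i2 : Integrable (fun ω => 1 + t * Y k ω) μ := (integrable_const _).add i1
      rw [integral_add i2 ((hY2i k).const_mul _), integral_add (integrable_const _) i1,
        integral_const_mul, integral_const_mul, ht2]
      simp
    rw [h1'] at h1
    have h2 := mul_le_mul_of_nonneg_left (hV k) (sq_nonneg a)
    have h3 := Real.add_one_le_exp (t * (∫ ω, Y k ω ∂μ) + a ^ 2 * V)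
    linarith
  set m := ∑ k, ∫ ω, Y k ω ∂μ with hmdef
  have hsum : ∀ t : ℝ, |t| = a → Integrable (fun ω => Real.exp (t * (∑ k, Y k) ω)) μ ∧
      mgf (∑ k, Y k) μ t ≤ Real.exp (t * m + n * (a ^ 2 * V)) := by
    intro t ht
    have e := hind.mgf_sum₀ (t := t) hm Finset.univ
    constructor
    · apply integrable_exp_mul_of_mgf_pos
      rw [e]
      exact Finset.prod_pos fun k _ => mgf_pos (hexpi t ht k)
    · rw [e]
      refine (Finset.prod_le_prod (fun i _ => mgf_nonneg) fun k _ => hmgf t ht k).trans ?_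
      rw [← Real.exp_sum, Finset.sum_add_distrib, ← Finset.mul_sum]
      simp [hmdef]
  have hup := measure_ge_le_exp_mul_mgf (m + (n * (a * V) + L / a)) ha.le
    (hsum a (abs_of_pos ha)).1
  have hlo := measure_le_le_exp_mul_mgf (m - (n * (a * V) + L / a)) (t := -a) (by linarith)
    (hsum (-a) (by rw [abs_neg, abs_of_pos ha])).1
  have hup' : μ.real {ω | m + (n * (a * V) + L / a) ≤ (∑ k, Y k) ω} ≤ Real.exp (-L) := by
    refine hup.trans ((mul_le_mul_of_nonneg_left (hsum a (abs_of_pos ha)).2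
      (Real.exp_pos _).le).trans ?_)
    rw [← Real.exp_add]
    apply le_of_eq; congr 1; field_simp; ring
  have hlo' : μ.real {ω | (∑ k, Y k) ω ≤ m - (n * (a * V) + L / a)} ≤ Real.exp (-L) := by
    refine hlo.trans ((mul_le_mul_of_nonneg_left
      (hsum (-a) (by rw [abs_neg, abs_of_pos ha])).2 (Real.exp_pos _).le).trans ?_)
    rw [← Real.exp_add]
    apply le_of_eq; congr 1; field_simp; ring
  have hsub : {ω | n * (a * V) + L / a ≤ |∑ k, Y k ω - ∑ k, ∫ ω', Y k ω' ∂μ|} ⊆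
      {ω | m + (n * (a * V) + L / a) ≤ (∑ k, Y k) ω} ∪
      {ω | (∑ k, Y k) ω ≤ m - (n * (a * V) + L / a)} := by
    intro ω hω
    simp only [Set.mem_ofPred_eq, Finset.sum_apply, Set.mem_union] at hω ⊢
    rcases le_abs.1 hω with h | h
    · left; linarith
    · right; linarith
  calc _ ≤ _ := measureReal_mono hsub
    _ ≤ _ := measureReal_union_le _ _
    _ ≤ _ := by linarith

end Moments

/-! ### Optimality conditions for a quartic form on the sphere -/

theorem nonpos_of_eventually_pow_mul_nonpos {g : ℝ → ℝ} (hg : Continuous g) (k : ℕ)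
    (h : ∀ᶠ t in nhdsWithin (0 : ℝ) (Set.Ioi 0), t ^ k * g t ≤ 0) : g 0 ≤ 0 := by
  have hlim : Filter.Tendsto g (nhdsWithin 0 (Set.Ioi 0)) (nhds (g 0)) :=
    hg.continuousAt.tendsto.mono_left nhdsWithin_le_nhds
  refine le_of_tendsto hlim ?_
  filter_upwards [h, self_mem_nhdsWithin] with t ht htpos
  exact nonpos_of_mul_nonpos_right ht (pow_pos htpos k)

theorem quartic_coefficients_of_local_nonpos {p₁ p₂ p₃ p₄ : ℝ}
    (h : ∀ᶠ t in nhds (0 : ℝ), p₁ * t + p₂ * t ^ 2 + p₃ * t ^ 3 + p₄ * t ^ 4 ≤ 0) :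
    p₁ = 0 ∧ p₂ ≤ 0 := by
  have hneg : ∀ᶠ t in nhds (0 : ℝ), p₁ * -t + p₂ * (-t) ^ 2 + p₃ * (-t) ^ 3 + p₄ * (-t) ^ 4 ≤ 0 := by
    have : Filter.Tendsto (fun t : ℝ => -t) (nhds 0) (nhds 0) := by
      simpa using (continuous_neg (G := ℝ)).tendsto 0
    exact this.eventually h
  have h1 : p₁ ≤ 0 := by
    have := nonpos_of_eventually_pow_mul_nonpos
      (g := fun t => p₁ + p₂ * t + p₃ * t ^ 2 + p₄ * t ^ 3) (by fun_prop) 1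
      (by filter_upwards [h.filter_mono nhdsWithin_le_nhds] with t ht; linarith [ht])
    simpa using this
  have h2 : -p₁ ≤ 0 := by
    have := nonpos_of_eventually_pow_mul_nonpos
      (g := fun t => -p₁ + p₂ * t - p₃ * t ^ 2 + p₄ * t ^ 3) (by fun_prop) 1
      (by filter_upwards [hneg.filter_mono nhdsWithin_le_nhds] with t ht; linarith [ht])
    simpa using this
  have h0 : p₁ = 0 := by linarith
  refine ⟨h0, ?_⟩
  subst h0
  have := nonpos_of_eventually_pow_mul_nonpos
    (g := fun t => p₂ + p₃ * t + p₄ * t ^ 2) (by fun_prop) 2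
    (by filter_upwards [h.filter_mono nhdsWithin_le_nhds] with t ht; linarith [ht])
  simpa using this

theorem sum_quartic {ι : Type*} [Fintype ι] (a b : ι → ℝ) (s t : ℝ) :
    ∑ k, (s * a k + t * b k) ^ 4 = s ^ 4 * ∑ k, a k ^ 4 + 4 * s ^ 3 * t * ∑ k, a k ^ 3 * b k +
      6 * s ^ 2 * t ^ 2 * ∑ k, a k ^ 2 * b k ^ 2 + 4 * s * t ^ 3 * ∑ k, a k * b k ^ 3 +
      t ^ 4 * ∑ k, b k ^ 4 := by
  simp only [Finset.mul_sum, ← Finset.sum_add_distrib]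
  refine Finset.sum_congr rfl fun k _ => ?_
  ring

/-- Local minimality is tested along the normalized curve through `q + t v`. Homogeneity of degree 4
clears the normalization and leaves a polynomial inequality in `t`, which replaces Riemannian
calculus. -/
theorem IsLocalSolution.eventually_le {p n : ℕ} {θ σ : ℝ} (hθ : 0 < θ) (hσ : 0 < σ) (hn : 0 < n)
    {Y : Matrix (Fin p) (Fin n) ℝ} {q : EuclideanSpace ℝ (Fin p)} (h : IsLocalSolution θ σ Y q)
    {v : EuclideanSpace ℝ (Fin p)} (hv : inner ℝ q v = 0) :
    ∀ᶠ t in nhds (0 : ℝ), ∑ k, ((Yᵀ *ᵥ q.ofLp) k + t * (Yᵀ *ᵥ v.ofLp) k) ^ 4 ≤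
      (1 + t ^ 2 * ‖v‖ ^ 2) ^ 2 * ∑ k, (Yᵀ *ᵥ q.ofLp) k ^ 4 := by
  obtain ⟨hq, hmin⟩ := h
  have hq1 : ‖q‖ = 1 := by simpa using hq
  have hnorm : ∀ t : ℝ, ‖q + t • v‖ ^ 2 = 1 + t ^ 2 * ‖v‖ ^ 2 := fun t => by
    rw [norm_add_sq_real, inner_smul_right, hv, hq1, norm_smul, mul_pow, Real.norm_eq_abs, sq_abs]
    ring
  have hpos : ∀ t : ℝ, 0 < ‖q + t • v‖ := fun t => by
    have h1 := hnorm t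
    have : 0 < ‖q + t • v‖ ^ 2 := by rw [h1]; positivity
    exact lt_of_pow_lt_pow_left₀ 2 (norm_nonneg _) (by simpa using this)
  have htend : Filter.Tendsto (fun t : ℝ => ‖q + t • v‖⁻¹ • (q + t • v)) (nhds 0)
      (nhdsWithin q (Metric.sphere 0 1)) := by
    refine tendsto_nhdsWithin_iff.2 ⟨?_, Filter.Eventually.of_forall fun t => ?_⟩
    · have hc : ContinuousAt (fun t : ℝ => ‖q + t • v‖⁻¹ • (q + t • v)) 0 := by
        have hc0 : Continuous fun t : ℝ => q + t • v := by fun_prop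
        exact ContinuousAt.smul (hc0.norm.continuousAt.inv₀ (hpos 0).ne') hc0.continuousAt
      have := hc.tendsto
      simpa [hq1] using this
    · rw [mem_sphere_zero_iff_norm, norm_smul, norm_inv, norm_norm, inv_mul_cancel₀ (hpos t).ne']
  filter_upwards [htend.eventually hmin] with t ht
  have hC : 0 < 1 / (12 * θ * σ ^ 4 * n) := by
    have : (0 : ℝ) < n := by exact_mod_cast hn
    positivity
  unfold objective at ht
  have ht2 := le_of_mul_le_mul_left (by linarith : 1 / (12 * θ * σ ^ 4 * n) *
    ∑ k, |(Yᵀ *ᵥ (‖q + t • v‖⁻¹ • (q + t • v)).ofLp) k| ^ 4 ≤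
    1 / (12 * θ * σ ^ 4 * n) * ∑ k, |(Yᵀ *ᵥ q.ofLp) k| ^ 4) hC
  have e : ∀ y : ℝ, |y| ^ 4 = y ^ 4 := fun y => by rw [Even.pow_abs (by decide)]
  simp only [e, WithLp.ofLp_smul, WithLp.ofLp_add, Matrix.mulVec_smul, Matrix.mulVec_add,
    Pi.smul_apply, Pi.add_apply, smul_eq_mul, mul_pow, ← Finset.mul_sum] at ht2
  rw [inv_pow, inv_mul_le_iff₀ (pow_pos (hpos t) 4)] at ht2
  rw [← hnorm t, ← pow_mul]
  exact ht2

/-- The coefficients of `t` and `t²` give the first two claims. The third comes from `t⁴`: when the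
form vanishes at `q`, every lower coefficient vanishes too. It serves to exclude such degenerate
points. -/
theorem IsLocalSolution.conditions {p n : ℕ} {θ σ : ℝ} (hθ : 0 < θ) (hσ : 0 < σ) (hn : 0 < n)
    {Y : Matrix (Fin p) (Fin n) ℝ} {q : EuclideanSpace ℝ (Fin p)} (h : IsLocalSolution θ σ Y q)
    {v : EuclideanSpace ℝ (Fin p)} (hv : inner ℝ q v = 0) :
    ∑ k, (Yᵀ *ᵥ q.ofLp) k ^ 3 * (Yᵀ *ᵥ v.ofLp) k = 0 ∧
    3 * ∑ k, (Yᵀ *ᵥ q.ofLp) k ^ 2 * (Yᵀ *ᵥ v.ofLp) k ^ 2 ≤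
      ‖v‖ ^ 2 * ∑ k, (Yᵀ *ᵥ q.ofLp) k ^ 4 ∧
    (∑ k, (Yᵀ *ᵥ q.ofLp) k ^ 4 = 0 → ∑ k, (Yᵀ *ᵥ v.ofLp) k ^ 4 ≤ 0) := by
  have hev := h.eventually_le hθ hσ hn hv
  set a := Yᵀ *ᵥ q.ofLp
  set b := Yᵀ *ᵥ v.ofLp
  have hq := fun t : ℝ => sum_quartic a b 1 t
  simp only [one_mul] at hq
  have hco := quartic_coefficients_of_local_nonpos (p₁ := 4 * ∑ k, a k ^ 3 * b k)
    (p₂ := 6 * ∑ k, a k ^ 2 * b k ^ 2 - 2 * ‖v‖ ^ 2 * ∑ k, a k ^ 4)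
    (p₃ := 4 * ∑ k, a k * b k ^ 3) (p₄ := ∑ k, b k ^ 4 - ‖v‖ ^ 4 * ∑ k, a k ^ 4) (by
      filter_upwards [hev] with t ht
      rw [hq t] at ht
      linarith [ht])
  refine ⟨by linarith [hco.1], by linarith [hco.2], fun h0 => ?_⟩
  have ha : ∀ k, a k = 0 := fun k => by
    have := (Finset.sum_eq_zero_iff_of_nonneg (fun k _ => by positivity)).1 h0 k (Finset.mem_univ k)
    simpa using this
  simp only [ha, zero_add, mul_pow, ← Finset.mul_sum] at hev
  have := nonpos_of_eventually_pow_mul_nonpos (g := fun _ => ∑ k, b k ^ 4) continuous_const 4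
    (by filter_upwards [hev.filter_mono nhdsWithin_le_nhds] with t ht; simpa using ht)
  exact this

/-! ### Landscape of a perturbed population quartic -/

/-- Interpolation at `t / s = 0, ∞, ±1/τ, ±2/τ`. With `τ = 1`, the odd parts at 1 and 2 satisfy `|4
d₁ + 4 d₃| ≤ 4 δ` and `|8 d₁ + 32 d₃| ≤ 25 δ`, whence `24 |d₁| ≤ 57 δ`. The even part at 1 gives `6
|d₂| ≤ 4 δ + 2 δ`. -/
theorem abs_coefficients_le_of_abs_quartic_le {d₀ d₁ d₂ d₃ d₄ δ τ : ℝ} (hτ : 0 < τ)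
    (h : ∀ s t : ℝ, |s ^ 4 * d₀ + 4 * s ^ 3 * t * d₁ + 6 * s ^ 2 * t ^ 2 * d₂ +
      4 * s * t ^ 3 * d₃ + t ^ 4 * d₄| ≤ δ * (s ^ 2 + t ^ 2 * τ ^ 2) ^ 2) :
    |d₀| ≤ δ ∧ |d₁| ≤ 12 / 5 * (δ * τ) ∧ |d₂| ≤ δ * τ ^ 2 := by
  have e0 := abs_le.1 (h 1 0)
  have e4 := abs_le.1 (h 0 1)
  have e1 := abs_le.1 (h τ 1)
  have e2 := abs_le.1 (h τ (-1))
  have e3 := abs_le.1 (h τ 2)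
  have e5 := abs_le.1 (h τ (-2))
  ring_nf at e0 e1 e2 e3 e4 e5
  have h2 : 0 < τ ^ 2 := by positivity
  have h3 : 0 < τ ^ 3 := by positivity
  have m0 := mul_le_mul_of_nonneg_left e0.1 (pow_nonneg h2.le 2)
  have m1 := mul_le_mul_of_nonneg_left e0.2 (pow_nonneg h2.le 2)
  refine ⟨abs_le.2 e0, abs_le.2 ⟨?_, ?_⟩, abs_le.2 ⟨?_, ?_⟩⟩
  · refine le_of_mul_le_mul_left ?_ h3
    linarith [e1, e2, e3, e5]
  · refine le_of_mul_le_mul_left ?_ h3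
    linarith [e1, e2, e3, e5]
  · refine le_of_mul_le_mul_left ?_ h2
    linarith [e1, e2, e4, m0, m1]
  · refine le_of_mul_le_mul_left ?_ h2
    linarith [e1, e2, e4, m0, m1]

/-- The expectation of `⟨x, a⟩⁴ / (3 θ)` for a vector `x` with independent entries distributed as
the product of a `Ber(θ)` and a `N(0, 1)` variable. -/
def populationQuartic {ι : Type*} [Fintype ι] (θ : ℝ) (a : ι → ℝ) : ℝ :=
  (1 - θ) * ∑ i, a i ^ 4 + θ * (∑ i, a i ^ 2) ^ 2

theorem one_sub_sq_le_of_second_order {ι κ : Type*} [Fintype ι] [Fintype κ] [DecidableEq ι]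
    {θ c δ : ℝ} (hθ : θ ≤ 1 / 9) (hc : 0 ≤ c) {x : κ → ι → ℝ}
    (hdev : ∀ a : ι → ℝ, |c * ∑ k, (x k ⬝ᵥ a) ^ 4 - populationQuartic θ a| ≤
      δ * (∑ i, a i ^ 2) ^ 2)
    {u : ι → ℝ} (hu : ∑ i, u i ^ 2 = 1)
    (hcrit : ∀ w : ι → ℝ, u ⬝ᵥ w = 0 → ∑ k, (x k ⬝ᵥ u) ^ 3 * (x k ⬝ᵥ w) = 0 ∧
      3 * ∑ k, (x k ⬝ᵥ u) ^ 2 * (x k ⬝ᵥ w) ^ 2 ≤ (∑ i, w i ^ 2) * ∑ k, (x k ⬝ᵥ u) ^ 4)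
    {i : ι} (hi : ∀ j, u j ^ 2 ≤ u i ^ 2) (hδ : δ ≤ u i ^ 2 / 45) :
    1 - u i ^ 2 ≤ 23 * δ := by
  have hδ0 : 0 ≤ δ := by
    have := (abs_nonneg _).trans (hdev u)
    rw [hu] at this
    linarith
  set m := u i ^ 2 with hm
  have hsplit : ∀ f : ι → ℝ, ∑ j, f j = f i + ∑ j ∈ Finset.univ.erase i, f j := fun f =>
    (Finset.add_sum_erase _ f (Finset.mem_univ i)).symm
  have hrest : ∑ j ∈ Finset.univ.erase i, u j ^ 2 = 1 - m := by
    have := hsplit fun j => u j ^ 2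
    rw [hu] at this
    linarith
  have hm1 : m ≤ 1 := by
    have : 0 ≤ ∑ j ∈ Finset.univ.erase i, u j ^ 2 := Finset.sum_nonneg fun _ _ => sq_nonneg _
    linarith
  rcases hm1.eq_or_lt with h1 | hlt
  · rw [h1]; linarith
  set τ := √(1 - m) with hτdef
  have hτ : 0 < τ := Real.sqrt_pos.2 (by linarith)
  have hτ2 : τ ^ 2 = 1 - m := Real.sq_sqrt (by linarith)
  -- The component of `e i` orthogonal to `u`; its squared norm is `1 - m = τ²`.
  set w : ι → ℝ := fun j => (if j = i then 1 else 0) - u i * u j with hw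
  have hwi : w i = 1 - m := by simp [hw, hm]; ring
  have huw : u ⬝ᵥ w = 0 := by
    have : ∀ j, u j * w j = (if j = i then u j else 0) - u i * u j ^ 2 := fun j => by
      simp only [hw]; split_ifs <;> ring
    simp only [dotProduct, this, Finset.sum_sub_distrib, ← Finset.mul_sum, hu]
    simp
  have hww : ∑ j, w j ^ 2 = τ ^ 2 := by
    have : ∀ j, w j ^ 2 = (if j = i then 1 - 2 * u i * u j else 0) + m * u j ^ 2 := fun j => by
      simp only [hw, hm]; split_ifs <;> ring
    simp only [this, Finset.sum_add_distrib, ← Finset.mul_sum, hu, hτ2]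
    simp only [Finset.sum_ite_eq', Finset.mem_univ, if_true, hm]
    ring
  set U4 := ∑ j, u j ^ 4 with hU4
  have hU31 : ∑ j, u j ^ 3 * w j = u i * (m - U4) := by
    have : ∀ j, u j ^ 3 * w j = (if j = i then u j ^ 3 else 0) - u i * u j ^ 4 := fun j => by
      simp only [hw]; split_ifs <;> ring
    simp only [this, Finset.sum_sub_distrib, ← Finset.mul_sum]
    simp only [Finset.sum_ite_eq', Finset.mem_univ, if_true, hm]
    ring
  set U22 := ∑ j, u j ^ 2 * w j ^ 2 with hU22
  have hU22le : m * (1 - m) ^ 2 ≤ U22 := by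
    have := Finset.single_le_sum (f := fun j => u j ^ 2 * w j ^ 2)
      (fun j _ => by positivity) (Finset.mem_univ i)
    simpa only [hwi] using this
  have hU4m : U4 ≤ m := by
    calc U4 = ∑ j, u j ^ 2 * u j ^ 2 := Finset.sum_congr rfl fun j _ => by ring
      _ ≤ ∑ j, m * u j ^ 2 := Finset.sum_le_sum fun j _ =>
        mul_le_mul_of_nonneg_right (hi j) (sq_nonneg _)
      _ = m := by rw [← Finset.mul_sum, hu, mul_one]
  have hU4le : U4 ≤ m ^ 2 + (1 - m) ^ 2 := by
    have h2 := Finset.sum_sq_le_sq_sum_of_nonneg (s := Finset.univ.erase i)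
      (f := fun j => u j ^ 2) (fun j _ => sq_nonneg _)
    have h3 := hsplit fun j => u j ^ 4
    simp only [← pow_mul, hrest] at h2
    norm_num at h2
    rw [hU4, h3, hm]
    nlinarith [h2]
  obtain ⟨hs1, hs2⟩ := hcrit w huw
  rw [hww] at hs2
  have hm0 : 0 ≤ m := sq_nonneg _
  clear_value τ w U4 U22 m
  have hexp : ∀ s t : ℝ, |s ^ 4 * (c * ∑ k, (x k ⬝ᵥ u) ^ 4 - (1 - θ) * U4 - θ) +
      4 * s ^ 3 * t * (-((1 - θ) * (u i * (m - U4)))) +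
      6 * s ^ 2 * t ^ 2 * (c * ∑ k, (x k ⬝ᵥ u) ^ 2 * (x k ⬝ᵥ w) ^ 2 - (1 - θ) * U22 -
        θ * τ ^ 2 / 3) +
      4 * s * t ^ 3 * (c * ∑ k, (x k ⬝ᵥ u) * (x k ⬝ᵥ w) ^ 3 - (1 - θ) * ∑ j, u j * w j ^ 3) +
      t ^ 4 * (c * ∑ k, (x k ⬝ᵥ w) ^ 4 - (1 - θ) * ∑ j, w j ^ 4 - θ * τ ^ 4)| ≤
      δ * (s ^ 2 + t ^ 2 * τ ^ 2) ^ 2 := by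
    intro s t
    have hsq : ∑ j, (s * u j + t * w j) ^ 2 = s ^ 2 + t ^ 2 * τ ^ 2 := by
      have : ∀ j, (s * u j + t * w j) ^ 2 =
          s ^ 2 * u j ^ 2 + 2 * s * t * (u j * w j) + t ^ 2 * w j ^ 2 := fun j => by ring
      simp only [this, Finset.sum_add_distrib, ← Finset.mul_sum, hu, hww]
      rw [show ∑ j, u j * w j = 0 from huw]
      ring
    have := hdev fun j => s * u j + t * w j
    have hdot : ∀ k, (x k ⬝ᵥ fun j => s * u j + t * w j) = s * (x k ⬝ᵥ u) + t * (x k ⬝ᵥ w) :=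
      fun k => by
        simp only [dotProduct, Finset.mul_sum, ← Finset.sum_add_distrib]
        exact Finset.sum_congr rfl fun j _ => by ring
    simp only [populationQuartic, hdot, hsq] at this
    rw [sum_quartic u w, sum_quartic (fun k => x k ⬝ᵥ u) (fun k => x k ⬝ᵥ w), hs1, hU31, ← hU4,
      ← hU22] at this
    refine le_trans (le_of_eq ?_) this
    congr 1
    ring
  obtain ⟨b0, b1, b2⟩ := abs_coefficients_le_of_abs_quartic_le hτ hexp
  have hm35 : 3 / 5 ≤ m := by
    -- The contributions of `θ ‖·‖₂⁴` cancel, that term being constant on the sphere. The error is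
    -- `3 δ τ²` from the mixed coefficient plus `δ τ²` from the leading one.
    have h3 : (1 - θ) * (3 * U22 - τ ^ 2 * U4) ≤ 4 * δ * τ ^ 2 := by
      have := mul_le_mul_of_nonneg_left hs2 hc
      have := mul_le_mul_of_nonneg_left (abs_le.1 b0).2 (sq_nonneg τ)
      linarith [(abs_le.1 b2).1]
    have h4 : τ ^ 2 * (m * (3 * (1 - m) - 1)) ≤ 3 * U22 - τ ^ 2 * U4 := by
      have := mul_le_mul_of_nonneg_left hU4m (sq_nonneg τ)
      rw [hτ2] at this ⊢
      linarith [hU22le]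
    have h5 : τ ^ 2 * ((1 - θ) * (m * (3 * (1 - m) - 1))) ≤ τ ^ 2 * (4 * δ) := by
      have := mul_le_mul_of_nonneg_left h4 (by linarith : 0 ≤ 1 - θ)
      linarith [this]
    have h6 := le_of_mul_le_mul_left h5 (by positivity)
    by_contra hcon
    push Not at hcon
    have hmpos : 0 < m := by
      rcases hm0.eq_or_lt with h0 | h0
      · exfalso
        have : ∑ j, u j ^ 2 ≤ 0 := Finset.sum_nonpos fun j _ => (hi j).trans h0.ge
        linarith
      · exact h0
    -- If `m < 3/5`, this yields `8 m / 45 ≤ 4 δ`, contradicting `δ ≤ m / 45`: the source of the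
    -- constant 45.
    have h7 : (8 : ℝ) / 9 * (1 / 5) ≤ (1 - θ) * (3 * (1 - m) - 1) :=
      mul_le_mul (by linarith) (by linarith) (by norm_num) (by linarith)
    linarith [mul_le_mul_of_nonneg_left h7 hmpos.le]
  have hui : 3 / 5 ≤ |u i| := by
    have : (3 / 5 : ℝ) ^ 2 ≤ |u i| ^ 2 := by rw [sq_abs, ← hm]; linarith
    exact le_of_sq_le_sq this (abs_nonneg _)
  -- Here `m - U4 ≥ m - m² - (1 - m)² = (1 - m) (2 m - 1)`, and `2 m - 1 ≥ 1/5`.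
  have hgap : τ ^ 2 / 5 ≤ m - U4 := by rw [hτ2]; nlinarith
  have hfirst : 8 / 9 * (3 / 5 * (τ ^ 2 / 5)) ≤ 12 / 5 * (δ * τ) := by
    refine le_trans ?_ b1
    rw [abs_neg, abs_mul, abs_mul, abs_of_nonneg (by linarith : 0 ≤ 1 - θ),
      abs_of_nonneg (le_trans (by positivity) hgap)]
    gcongr <;> linarith
  -- The exact constant is `(12/5) / (8/75) = 22.5`. Since `τ ≤ 1`, the bound on `τ` also bounds
  -- `τ²`.
  have hτδ : τ ≤ 23 * δ := by
    refine le_of_mul_le_mul_left ?_ hτ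
    have : 0 ≤ δ * τ := by positivity
    linarith [hfirst]
  have hτ1 : τ ≤ 1 := by
    have : τ ^ 2 ≤ 1 ^ 2 := by rw [hτ2]; linarith
    exact le_of_sq_le_sq this (by norm_num)
  rw [← hτ2]
  nlinarith

/-! ### From the coordinates `Aᵀ q` back to the sphere -/

theorem exists_isSignedPermutation_col {r : ℕ} (j i : Fin r) {s : ℝ} (hs : s = 1 ∨ s = -1) :
    ∃ P : Matrix (Fin r) (Fin r) ℝ, IsSignedPermutation P ∧ P.col j = Pi.single i s := by
  refine ⟨fun a b => if a = Equiv.swap j i b then s else 0,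
    ⟨Equiv.swap j i, fun _ => s, fun _ => hs, fun _ _ => rfl⟩, ?_⟩
  ext a
  simp only [Matrix.col, Pi.single_apply]
  change (if a = Equiv.swap j i j then s else 0) = _
  rw [Equiv.swap_apply_left]

theorem exists_signedPermutation_near_of_isLocalSolution {p r n : ℕ} (hr : 0 < r) (hn : 0 < n)
    {A : Matrix (Fin p) (Fin r) ℝ} (hA : Aᵀ * A = 1) {θ σ cs δ : ℝ} (hθ0 : 0 < θ)
    (hθ : θ ≤ 1 / 9) (hσ : 0 < σ) (hcs : cs ≤ 1 / 4) (hδ : δ ≤ cs / 45)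
    {X : Matrix (Fin r) (Fin n) ℝ}
    (hdev : ∀ a : Fin r → ℝ, |1 / (3 * θ * n) * ∑ k, ((fun i => X i k / σ) ⬝ᵥ a) ^ 4 -
      populationQuartic θ a| ≤ δ * (∑ i, a i ^ 2) ^ 2)
    {q : EuclideanSpace ℝ (Fin p)} (hq : IsLocalSolution θ σ (A * X) q)
    (hqcs : q ∉ nullRegion A cs) :
    ∃ P : Matrix (Fin r) (Fin r) ℝ, IsSignedPermutation P ∧
      ‖q - WithLp.toLp 2 ((A * P).col ⟨0, hr⟩)‖ ^ 2 ≤ 46 * δ := by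
  have hq1 : ‖q‖ = 1 := by simpa using hq.1
  set u : Fin r → ℝ := Aᵀ *ᵥ q.ofLp with hu
  set x : Fin n → Fin r → ℝ := fun k i => X i k / σ with hx
  have hinner : ∀ w : Fin r → ℝ, inner ℝ q (WithLp.toLp 2 (A *ᵥ w)) = u ⬝ᵥ w := fun w => by
    rw [EuclideanSpace.inner_eq_star_dotProduct]
    simp only [star_trivial]
    rw [hu, Matrix.mulVec_transpose, ← Matrix.dotProduct_mulVec, dotProduct_comm]
  have hAA : ∀ w : Fin r → ℝ, Aᵀ *ᵥ (A *ᵥ w) = w := fun w => by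
    rw [Matrix.mulVec_mulVec, hA, Matrix.one_mulVec]
  have hnormA : ∀ w : Fin r → ℝ, ‖(WithLp.toLp 2 (A *ᵥ w) : EuclideanSpace ℝ (Fin p))‖ ^ 2 =
      ∑ i, w i ^ 2 := fun w => by
    rw [← real_inner_self_eq_norm_sq, EuclideanSpace.inner_eq_star_dotProduct]
    simp only [star_trivial]
    rw [Matrix.dotProduct_mulVec, ← Matrix.mulVec_transpose, hAA]
    simp [dotProduct, sq]
  have hY : ∀ (v : Fin p → ℝ) (k : Fin n), ((A * X)ᵀ *ᵥ v) k = σ * (x k ⬝ᵥ (Aᵀ *ᵥ v)) := by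
    intro v k
    rw [Matrix.transpose_mul, ← Matrix.mulVec_mulVec]
    simp only [Matrix.mulVec, dotProduct, Finset.mul_sum, Matrix.transpose_apply, hx]
    refine Finset.sum_congr rfl fun i _ => ?_
    field_simp
  have hcond : ∀ v : EuclideanSpace ℝ (Fin p), inner ℝ q v = 0 →
      ∑ k, (x k ⬝ᵥ u) ^ 3 * (x k ⬝ᵥ (Aᵀ *ᵥ v.ofLp)) = 0 ∧
      3 * ∑ k, (x k ⬝ᵥ u) ^ 2 * (x k ⬝ᵥ (Aᵀ *ᵥ v.ofLp)) ^ 2 ≤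
        ‖v‖ ^ 2 * ∑ k, (x k ⬝ᵥ u) ^ 4 ∧
      (∑ k, (x k ⬝ᵥ u) ^ 4 = 0 → ∑ k, (x k ⬝ᵥ (Aᵀ *ᵥ v.ofLp)) ^ 4 ≤ 0) := by
    intro v hv
    obtain ⟨h1, h2, h3⟩ := hq.conditions hθ0 hσ hn hv
    simp only [hY, ← hu] at h1 h2 h3
    have hσ4 : 0 < σ ^ 4 := by positivity
    have e1 : ∀ y z : ℝ, (σ * y) ^ 3 * (σ * z) = σ ^ 4 * (y ^ 3 * z) := fun y z => by ring
    have e2 : ∀ y z : ℝ, (σ * y) ^ 2 * (σ * z) ^ 2 = σ ^ 4 * (y ^ 2 * z ^ 2) := fun y z => by ring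
    have e3 : ∀ y : ℝ, (σ * y) ^ 4 = σ ^ 4 * y ^ 4 := fun y => by ring
    simp only [e1, e2, e3, ← Finset.mul_sum] at h1 h2 h3
    refine ⟨(mul_eq_zero.1 h1).resolve_left hσ4.ne', ?_, fun h0 => ?_⟩
    · refine le_of_mul_le_mul_left ?_ hσ4
      linarith
    · have := h3 (by rw [h0, mul_zero])
      exact nonpos_of_mul_nonpos_right this hσ4
  have hqu : ∀ (w : Fin r → ℝ) (b : ℝ), Aᵀ *ᵥ ((WithLp.toLp 2 (A *ᵥ w) - b • q :
      EuclideanSpace ℝ (Fin p))).ofLp = w - b • u := fun w b => by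
    simp [Matrix.mulVec_sub, Matrix.mulVec_smul, hAA, hu]
  have hperp : ∀ w : Fin r → ℝ, inner ℝ q (WithLp.toLp 2 (A *ᵥ w) - (u ⬝ᵥ w) • q) = 0 :=
    fun w => by
      rw [inner_sub_right, inner_smul_right, hinner, real_inner_self_eq_norm_sq, hq1]
      ring
  -- Otherwise the form would vanish at a basis vector as well, where the population value is 1 and
  -- the deviation is at most `δ ≤ 1/180`.
  have hpos : ∑ k, (x k ⬝ᵥ u) ^ 4 ≠ 0 := by
    intro h0
    set i₀ : Fin r := ⟨0, hr⟩
    have hxu : ∀ k, x k ⬝ᵥ u = 0 := fun k => by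
      have := (Finset.sum_eq_zero_iff_of_nonneg (fun k _ => by positivity)).1 h0 k
        (Finset.mem_univ k)
      simpa using this
    have h1 := (hcond _ (hperp (Pi.single i₀ 1))).2.2 h0
    simp only [hqu, dotProduct_sub, dotProduct_smul, hxu, smul_zero, sub_zero] at h1
    have h2 : ∑ k, (x k ⬝ᵥ Pi.single i₀ 1) ^ 4 = 0 :=
      le_antisymm h1 (Finset.sum_nonneg fun k _ => by positivity)
    have h3 := hdev (Pi.single i₀ 1)
    have e : ∀ m : ℕ, m ≠ 0 → ∑ i, (Pi.single i₀ (1 : ℝ) : Fin r → ℝ) i ^ m = 1 := fun m hm => by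
      rw [Finset.sum_eq_single i₀] <;> simp +contextual [hm]
    rw [h2, populationQuartic, e 4 (by norm_num), e 2 (by norm_num)] at h3
    norm_num at h3
    linarith
  -- The tangent vector `A u - ‖u‖² q` turns the first-order condition into `(1 - ‖u‖²) ∑ k, ⟨x k,
  -- u⟩⁴ = 0`. Thus `q` lies in the range of `A`, even when `p > r`.
  have hu1 : ∑ i, u i ^ 2 = 1 := by
    have h1 := (hcond _ (hperp u)).1
    have huu : u ⬝ᵥ u = ∑ i, u i ^ 2 := by simp [dotProduct, sq]
    have e : ∀ k, (x k ⬝ᵥ u) ^ 3 * (x k ⬝ᵥ (u - (u ⬝ᵥ u) • u)) =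
        (1 - ∑ i, u i ^ 2) * (x k ⬝ᵥ u) ^ 4 := fun k => by
      rw [dotProduct_sub, dotProduct_smul, huu, smul_eq_mul]; ring
    simp only [hqu, e, ← Finset.mul_sum] at h1
    linarith [(mul_eq_zero.1 h1).resolve_right hpos]
  have : Nonempty (Fin r) := ⟨⟨0, hr⟩⟩
  obtain ⟨i, hi⟩ := Finite.exists_max fun i => u i ^ 2
  have hcsi : cs < u i ^ 2 := by
    have h1 : cs < ‖u‖ ^ 2 := by
      by_contra hcon
      exact hqcs ⟨hq.1, not_lt.1 hcon⟩
    have h2 : ‖u‖ ≤ |u i| := by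
      rw [pi_norm_le_iff_of_nonneg (abs_nonneg _)]
      exact fun j => sq_le_sq.1 (hi j)
    have h3 := pow_le_pow_left₀ (norm_nonneg _) h2 2
    rw [sq_abs] at h3
    linarith
  have hbound := one_sub_sq_le_of_second_order hθ (c := 1 / (3 * θ * n)) (by positivity) hdev hu1
    (fun w hw => by
      have := hcond (WithLp.toLp 2 (A *ᵥ w)) (by rw [hinner, hw])
      rw [hnormA, hAA] at this
      exact ⟨this.1, this.2.1⟩) hi (by linarith)
  obtain ⟨s, hs, hsu⟩ : ∃ s : ℝ, (s = 1 ∨ s = -1) ∧ u i * s = |u i| := by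
    rcases abs_cases (u i) with h | h
    · exact ⟨1, Or.inl rfl, by linarith⟩
    · exact ⟨-1, Or.inr rfl, by linarith⟩
  obtain ⟨P, hP, hcol⟩ := exists_isSignedPermutation_col ⟨0, hr⟩ i hs
  refine ⟨P, hP, ?_⟩
  have hAP : (A * P).col ⟨0, hr⟩ = A *ᵥ Pi.single i s := by
    rw [← hcol]; rfl
  have hs2 : ∑ j, (Pi.single i s : Fin r → ℝ) j ^ 2 = 1 := by
    rw [Finset.sum_eq_single i]
    · rcases hs with h | h <;> simp [h]
    · simp +contextual
    · simp
  -- The squared distance is `2 - 2 |u i| ≤ 2 (1 - u i ^ 2) ≤ 46 δ`.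
  rw [hAP, norm_sub_sq_real, hnormA, hinner, hq1, hs2]
  simp only [dotProduct_single]
  have hab : u i ^ 2 ≤ |u i| := by
    have h1 : |u i| ≤ 1 := by
      have := Finset.single_le_sum (f := fun j => u j ^ 2) (fun j _ => sq_nonneg _)
        (Finset.mem_univ i)
      simp only [hu1] at this
      exact (sq_le_one_iff_abs_le_one _).1 this
    rw [← sq_abs]
    nlinarith [abs_nonneg (u i)]
  rw [hsu]
  linarith

/-- The quartic `⟨v, w⟩⁴`, set to zero where the squared norm of `v` exceeds `R`. -/
noncomputable def truncatedQuartic {r : ℕ} (R : ℝ) (w v : Fin r → ℝ) : ℝ :=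
  if ∑ i, v i ^ 2 ≤ R then (v ⬝ᵥ w) ^ 4 else 0

/-! ### Truncated quartics: size, Lipschitz dependence, variance and bias -/

section Truncation

variable {r : ℕ}

theorem sq_dotProduct_le (v w : Fin r → ℝ) :
    (v ⬝ᵥ w) ^ 2 ≤ (∑ i, v i ^ 2) * ∑ i, w i ^ 2 :=
  Finset.sum_mul_sq_le_sq_mul_sq _ _ _

theorem measurable_truncatedQuartic (R : ℝ) (w : Fin r → ℝ) :
    Measurable (truncatedQuartic R w) := by
  unfold truncatedQuartic dotProduct
  refine Measurable.ite (measurableSet_le (by fun_prop) (by fun_prop)) (by fun_prop) (by fun_prop)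

theorem truncatedQuartic_nonneg (R : ℝ) (w v : Fin r → ℝ) : 0 ≤ truncatedQuartic R w v := by
  unfold truncatedQuartic; split_ifs <;> positivity

theorem truncatedQuartic_le (R : ℝ) (w v : Fin r → ℝ) :
    truncatedQuartic R w v ≤ (v ⬝ᵥ w) ^ 4 := by
  unfold truncatedQuartic; split_ifs
  · exact le_rfl
  · positivity

theorem abs_truncatedQuartic_le {R : ℝ} (w v : Fin r → ℝ) {b : ℝ}
    (hw : ∑ i, w i ^ 2 ≤ b) : |truncatedQuartic R w v| ≤ (R * b) ^ 2 := by
  rw [abs_of_nonneg (truncatedQuartic_nonneg R w v)]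
  unfold truncatedQuartic
  split_ifs with h
  · have h1 := sq_dotProduct_le v w
    have h0 : 0 ≤ ∑ i, w i ^ 2 := Finset.sum_nonneg fun i _ => sq_nonneg _
    have h0' : 0 ≤ ∑ i, v i ^ 2 := Finset.sum_nonneg fun i _ => sq_nonneg _
    have h2 : (v ⬝ᵥ w) ^ 2 ≤ R * b := h1.trans (mul_le_mul h hw h0 (h0'.trans h))
    calc (v ⬝ᵥ w) ^ 4 = ((v ⬝ᵥ w) ^ 2) ^ 2 := by ring
      _ ≤ _ := pow_le_pow_left₀ (sq_nonneg _) h2 2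
  · positivity

/-- The cutoff depends on `v` alone, so truncation does not spoil the Lipschitz dependence on the
direction. -/
theorem abs_truncatedQuartic_sub_le {R η : ℝ} (hη : 0 ≤ η) {u w : Fin r → ℝ}
    (hu : ∑ i, u i ^ 2 ≤ 1) (hw : ∑ i, w i ^ 2 ≤ 4) (huw : ∑ i, (u i - w i) ^ 2 ≤ η ^ 2)
    (v : Fin r → ℝ) :
    |truncatedQuartic R u v - truncatedQuartic R w v| ≤ 15 * R ^ 2 * η := by
  unfold truncatedQuartic
  split_ifs with h
  · have h0' : 0 ≤ ∑ i, v i ^ 2 := Finset.sum_nonneg fun i _ => sq_nonneg _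
    have hR : 0 ≤ R := h0'.trans h
    have key : ∀ (y : Fin r → ℝ) (b : ℝ), 0 ≤ b → ∑ i, y i ^ 2 ≤ b ^ 2 →
        |v ⬝ᵥ y| ≤ √R * b := by
      intro y b hb hy
      refine abs_le_of_sq_le_sq ?_ (by positivity)
      rw [mul_pow, Real.sq_sqrt hR]
      exact (sq_dotProduct_le v y).trans
        (mul_le_mul h hy (Finset.sum_nonneg fun i _ => sq_nonneg _) hR)
    have ha := key u 1 zero_le_one (by simpa using hu)
    have hb := key w 2 zero_le_two (by norm_num; exact hw)
    have hd := key (u - w) η hη (by simpa using huw)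
    rw [dotProduct_sub] at hd
    set a := v ⬝ᵥ u
    set b := v ⬝ᵥ w
    have hs : √R ^ 2 = R := Real.sq_sqrt hR
    have h1 : |a + b| ≤ 3 * √R := (abs_add_le a b).trans (by linarith)
    have h2 : |a ^ 2 + b ^ 2| ≤ 5 * R := by
      rw [abs_of_nonneg (by positivity), ← sq_abs a, ← sq_abs b]
      have := pow_le_pow_left₀ (abs_nonneg _) ha 2
      have := pow_le_pow_left₀ (abs_nonneg _) hb 2
      nlinarith
    calc |a ^ 4 - b ^ 4| = |a - b| * |a + b| * |a ^ 2 + b ^ 2| := by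
          rw [← abs_mul, ← abs_mul]; congr 1; ring
      _ ≤ (√R * η) * (3 * √R) * (5 * R) := by gcongr
      _ = 15 * (√R ^ 2) * R * η := by ring
      _ = _ := by rw [hs]; ring
  · simp; positivity

variable {Ω : Type*} [MeasurableSpace Ω] {μ : Measure Ω} [IsProbabilityMeasure μ] {θ : ℝ}
  {X : Fin r → Ω → ℝ}

theorem integral_truncatedQuartic_sq_le (hθ0 : 0 ≤ θ) (hθ1 : θ ≤ 1)
    (hX : ∀ i, IsSparseGaussian μ θ (X i)) (hind : iIndepFun X μ) (R : ℝ) {w : Fin r → ℝ}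
    {b : ℝ} (hw : ∑ i, w i ^ 2 ≤ b) :
    ∫ ω, truncatedQuartic R w (fun i => X i ω) ^ 2 ∂μ ≤ 105 * θ * b ^ 4 := by
  obtain ⟨hi, -, -, -, h8⟩ := moments_sum_sparseGaussian hθ0 hθ1 hX hind w Finset.univ
  have h0 : 0 ≤ ∑ i, w i ^ 2 := Finset.sum_nonneg fun i _ => sq_nonneg _
  calc _ ≤ ∫ ω, (∑ i, X i ω * w i) ^ 8 ∂μ := by
        refine integral_mono_of_nonneg (ae_of_all _ fun ω => sq_nonneg _) (hi 8)
          (ae_of_all _ fun ω => ?_)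
        have := pow_le_pow_left₀ (truncatedQuartic_nonneg R w fun i => X i ω)
          (truncatedQuartic_le R w _) 2
        simpa only [← pow_mul, dotProduct] using this
    _ ≤ _ := h8
    _ ≤ _ := by gcongr

/-- On the tail event `y⁴ ≤ (a y⁸ + a⁻¹) / 2`, a weighted substitute for Cauchy-Schwarz; the weight
`a` is chosen later to balance the eighth moment against the tail probability. -/
theorem abs_integral_truncatedQuartic_sub_le (hθ0 : 0 ≤ θ) (hθ1 : θ ≤ 1)
    (hX : ∀ i, IsSparseGaussian μ θ (X i)) (hind : iIndepFun X μ) (R : ℝ) {u : Fin r → ℝ}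
    (hu : ∑ i, u i ^ 2 = 1) {a : ℝ} (ha : 0 < a) :
    |∫ ω, truncatedQuartic R u (fun i => X i ω) ∂μ - 3 * θ * populationQuartic θ u| ≤
      (a * (105 * θ) + a⁻¹ * Real.exp (θ * r / 2 - R / 4)) / 2 := by
  obtain ⟨hi, -, h4, -, h8⟩ := moments_sum_sparseGaussian hθ0 hθ1 hX hind u Finset.univ
  have hXm : AEMeasurable (fun ω i => X i ω) μ := aemeasurable_pi_lambda _ fun i => (hX i).1
  have hti : Integrable (fun ω => truncatedQuartic R u (fun i => X i ω)) μ := by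
    refine (hi 4).mono' ((measurable_truncatedQuartic R u).comp_aemeasurable
      hXm).aestronglyMeasurable (ae_of_all _ fun ω => ?_)
    rw [Real.norm_eq_abs, abs_of_nonneg (truncatedQuartic_nonneg _ _ _)]
    exact truncatedQuartic_le _ _ _
  have htail : NullMeasurableSet {ω | R ≤ ∑ i, X i ω ^ 2} μ :=
    nullMeasurableSet_le aemeasurable_const (Finset.aemeasurable_fun_sum _ fun i _ => (hX i).1.pow_const 2)
  rw [populationQuartic, ← h4, abs_sub_comm, ← integral_sub (hi 4) hti]
  have hind1 : Integrable ({ω | R ≤ ∑ i, X i ω ^ 2}.indicator fun _ => (1 : ℝ)) μ :=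
    (integrable_const _).indicator₀ htail
  have hnn : ∀ ω, 0 ≤ (∑ i, X i ω * u i) ^ 4 - truncatedQuartic R u (fun i => X i ω) :=
    fun ω => sub_nonneg.2 (truncatedQuartic_le _ _ _)
  rw [abs_of_nonneg (integral_nonneg hnn)]
  calc _ ≤ ∫ ω, (a / 2 * (∑ i, X i ω * u i) ^ 8 +
        a⁻¹ / 2 * {ω | R ≤ ∑ i, X i ω ^ 2}.indicator (fun _ => (1 : ℝ)) ω) ∂μ := by
        refine integral_mono ((hi 4).sub hti) (((hi 8).const_mul _).add (hind1.const_mul _))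
          fun ω => ?_
        simp only [truncatedQuartic, dotProduct]
        by_cases h : R ≤ ∑ i, X i ω ^ 2
        · have h1 : {ω | R ≤ ∑ i, X i ω ^ 2}.indicator (fun _ => (1 : ℝ)) ω = 1 :=
            Set.indicator_of_mem (s := {ω | R ≤ ∑ i, X i ω ^ 2}) h _
          rw [h1]
          set y := (∑ i, X i ω * u i)
          have h2 : y ^ 4 ≤ a / 2 * y ^ 8 + a⁻¹ / 2 * 1 := by
            have : a / 2 * y ^ 8 + a⁻¹ / 2 * 1 - y ^ 4 = (a * y ^ 4 - 1) ^ 2 / (2 * a) := by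
              field_simp; ring
            have : 0 ≤ (a * y ^ 4 - 1) ^ 2 / (2 * a) := by positivity
            linarith
          split_ifs
          · have : 0 ≤ y ^ 4 := by positivity
            linarith
          · linarith
        · have h1 : {ω | R ≤ ∑ i, X i ω ^ 2}.indicator (fun _ => (1 : ℝ)) ω = 0 :=
            Set.indicator_of_notMem (s := {ω | R ≤ ∑ i, X i ω ^ 2}) h _
          rw [h1, if_pos (not_le.1 h).le]
          have : 0 ≤ (∑ i, X i ω * u i) ^ 8 := by positivity
          simp; positivity
    _ = a / 2 * ∫ ω, (∑ i, X i ω * u i) ^ 8 ∂μ + a⁻¹ / 2 * μ.real {ω | R ≤ ∑ i, X i ω ^ 2} := by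
        rw [integral_add ((hi 8).const_mul _) (hind1.const_mul _), integral_const_mul,
          integral_const_mul, integral_indicator₀ htail]
        simp
    _ ≤ a / 2 * (105 * θ) + a⁻¹ / 2 * Real.exp (θ * r / 2 - R / 4) := by
        rw [hu] at h8
        gcongr
        · simpa using h8
        · exact measure_sum_sq_ge_le hθ0 hX hind R
    _ = _ := by ring

end Truncation

/-- The error rate of the empirical objective. -/
noncomputable def errorRate (r n : ℕ) (θ : ℝ) : ℝ :=
  √((r : ℝ) ^ 2 * Real.log n / (θ * n)) +
    (θ * (r : ℝ) ^ 2 + Real.log n ^ 2 / θ) * ((r : ℝ) * Real.log n / n)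

/-! ### Uniform deviation of the truncated quartics over the sphere -/

theorem exists_gridPoint_near {r : ℕ} {N : ℕ} (hN : 0 < N) {u : Fin r → ℝ}
    (hu : ∑ i, u i ^ 2 = 1) :
    ∃ z ∈ Fintype.piFinset (fun _ : Fin r => Finset.Icc (-(N : ℤ)) N),
      ∑ i, (u i - (z i : ℝ) / N) ^ 2 ≤ r * (1 / (N : ℝ)) ^ 2 := by
  have hNR : (0 : ℝ) < N := by exact_mod_cast hN
  refine ⟨fun i => ⌊N * u i⌋, ?_, ?_⟩
  · rw [Fintype.mem_piFinset]
    intro i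
    have h1 : |u i| ≤ 1 := by
      have := Finset.single_le_sum (f := fun j => u j ^ 2) (fun j _ => sq_nonneg _)
        (Finset.mem_univ i)
      simp only [hu] at this
      exact (sq_le_one_iff_abs_le_one _).1 this
    obtain ⟨h2, h3⟩ := abs_le.1 h1
    rw [Finset.mem_Icc]
    constructor
    · rw [Int.le_floor]; push_cast; nlinarith
    · have : (⌊N * u i⌋ : ℝ) ≤ N := (Int.floor_le _).trans (by nlinarith)
      exact_mod_cast this
  · calc ∑ i, (u i - (⌊N * u i⌋ : ℝ) / N) ^ 2 ≤ ∑ _i : Fin r, (1 / (N : ℝ)) ^ 2 := by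
          refine Finset.sum_le_sum fun i _ => ?_
          have h1 := Int.floor_le (N * u i)
          have h2 := (Int.lt_floor_add_one (N * u i)).le
          have e : u i - (⌊N * u i⌋ : ℝ) / N = (N * u i - ⌊N * u i⌋) / N := by field_simp
          rw [e]
          refine pow_le_pow_left₀ (div_nonneg (by linarith) hNR.le) ?_ 2
          exact div_le_div_of_nonneg_right (by linarith) hNR.le
      _ = _ := by simp

theorem exists_bernstein_parameter {n M V L : ℝ} (hn : 0 < n) (hM : 0 < M) (hV : 0 < V)
    (hL : 0 < L) :
    ∃ a, 0 < a ∧ a * M ≤ 1 ∧ n * (a * V) + L / a ≤ 2 * √(n * V * L) + L * M := by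
  have hs : 0 < √(n * V * L) := Real.sqrt_pos.2 (by positivity)
  have hs2 : √(n * V * L) ^ 2 = n * V * L := Real.sq_sqrt (by positivity)
  set S := √(n * V * L)
  -- This choice covers both Bernstein regimes at once: `L / a = S + L M` and `n a V ≤ S`.
  refine ⟨L / (S + L * M), by positivity, ?_, ?_⟩
  · rw [div_mul_eq_mul_div, div_le_one (by positivity)]
    linarith
  · have h1 : n * (L / (S + L * M) * V) ≤ S := by
      rw [show n * (L / (S + L * M) * V) = n * V * L / (S + L * M) by ring, ← hs2,
        div_le_iff₀ (by positivity)]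
      nlinarith [mul_pos hs (mul_pos hL hM)]
    have h2 : L / (L / (S + L * M)) = S + L * M := by field_simp
    rw [h2]; linarith

section Uniform

variable {Ω : Type*} [MeasurableSpace Ω] {μ : Measure Ω} [IsProbabilityMeasure μ] {θ : ℝ}
  {r n : ℕ} {X : Fin n → Fin r → Ω → ℝ}

theorem exists_uniform_truncatedQuartic_deviation (hθ0 : 0 < θ) (hθ1 : θ ≤ 1) (hr : 0 < r)
    (hn : 3 ≤ n) (hrn : r ≤ n)
    (hX : ∀ k i, IsSparseGaussian μ θ (X k i)) (hind : ∀ k, iIndepFun (X k) μ)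
    (hcol : iIndepFun (fun k ω i => X k i ω) μ) {R : ℝ} (hR : 0 < R) :
    ∃ bad : Set Ω, μ.real bad ≤ 2 / n ∧ ∀ ω ∉ bad, ∀ u : Fin r → ℝ, ∑ i, u i ^ 2 = 1 →
      |∑ k, truncatedQuartic R u (fun i => X k i ω) -
        ∑ k, ∫ ω', truncatedQuartic R u (fun i => X k i ω') ∂μ| ≤
      2 * √(n * (105 * θ * 4 ^ 4) * (4 * r * Real.log n)) +
        (4 * r * Real.log n) * (R * 4) ^ 2 + 30 * R ^ 2 := by
  have hnR : (3 : ℝ) ≤ n := by exact_mod_cast hn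
  have hrR : (1 : ℝ) ≤ r := by exact_mod_cast hr
  have hlog : 0 < Real.log n := Real.log_pos (by linarith)
  -- The grid has at most `n ^ (3 r)` points, so the union bound leaves `2 n ^ (-r) ≤ 2 / n`.
  set L : ℝ := 4 * r * Real.log n with hLdef
  have hL : 0 < L := by positivity
  obtain ⟨a, ha, haM, hT⟩ := exists_bernstein_parameter (n := (n : ℝ)) (M := (R * 4) ^ 2)
    (V := 105 * θ * 4 ^ 4) (L := L) (by linarith) (by positivity) (by positivity) hL
  have hN : 0 < r * n := by positivity
  -- Mesh `1 / (r n)` puts a grid point within `1 / n` of each unit vector. Summing `15 R² / n` over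
  -- `n` samples, for both the sums and their means, costs `30 R²`. The filter keeps squared norms
  -- at most 4, which fixes the Bernstein parameters.
  set net := (Fintype.piFinset (fun _ : Fin r => Finset.Icc (-((r * n : ℕ) : ℤ)) (r * n : ℕ))).filter
    fun z => ∑ i, ((z i : ℝ) / (r * n : ℕ)) ^ 2 ≤ 4 with hnet
  let Y : (Fin r → ℝ) → Fin n → Ω → ℝ := fun w k ω => truncatedQuartic R w (fun i => X k i ω)
  have hXm : ∀ k, AEMeasurable (fun ω i => X k i ω) μ :=
    fun k => aemeasurable_pi_lambda _ fun i => (hX k i).1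
  have hYm : ∀ w k, AEMeasurable (Y w k) μ := fun w k =>
    (measurable_truncatedQuartic R w).comp_aemeasurable (hXm k)
  have hYind : ∀ w, iIndepFun (Y w) μ := fun w =>
    hcol.comp (fun _ => truncatedQuartic R w) fun _ => measurable_truncatedQuartic R w
  let D : (Fin r → ℝ) → Ω → ℝ := fun w ω => ∑ k, Y w k ω - ∑ k, ∫ ω', Y w k ω' ∂μ
  let bad : Set Ω := ⋃ z ∈ net, {ω | n * (a * (105 * θ * 4 ^ 4)) + L / a ≤
    |D (fun i => (z i : ℝ) / (r * n : ℕ)) ω|}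
  refine ⟨bad, ?_, ?_⟩
  · have h1 : ∀ z ∈ net, μ.real {ω | n * (a * (105 * θ * 4 ^ 4)) + L / a ≤
        |D (fun i => (z i : ℝ) / (r * n : ℕ)) ω|} ≤ 2 * Real.exp (-L) := by
      intro z hz
      have hw := (Finset.mem_filter.1 hz).2
      exact bernstein_inequality (hYm _) (hYind _)
        (fun k ω => abs_truncatedQuartic_le _ _ hw)
        (fun k => integral_truncatedQuartic_sq_le hθ0.le hθ1 (hX k) (hind k) R hw) ha haM
    have h2 : (net.card : ℝ) ≤ Real.exp (3 * r * Real.log n) := by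
      have h3 : net.card ≤ (2 * (r * n) + 1) ^ r := by
        refine (Finset.card_filter_le _ _).trans ?_
        rw [Fintype.card_piFinset_const, Int.card_Icc]
        apply le_of_eq
        congr 1
        omega
      have h4 : 2 * (r * n) + 1 ≤ n ^ 3 := by
        have : r * n ≤ n * n := Nat.mul_le_mul_right _ hrn
        have h5 : 3 * (n * n) ≤ n * (n * n) := Nat.mul_le_mul_right _ hn
        have h6 : 1 ≤ n * n := Nat.mul_pos (by omega) (by omega)
        calc 2 * (r * n) + 1 ≤ 3 * (n * n) := by omega
          _ ≤ n * (n * n) := h5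
          _ = n ^ 3 := by ring
      have h5 : net.card ≤ (n ^ 3) ^ r := h3.trans (Nat.pow_le_pow_left h4 r)
      have h6 : (net.card : ℝ) ≤ ((n : ℝ) ^ 3) ^ r := by exact_mod_cast h5
      refine h6.trans (le_of_eq ?_)
      rw [show 3 * r * Real.log n = ((3 * r : ℕ) : ℝ) * Real.log n by push_cast; ring,
        Real.exp_nat_mul, Real.exp_log (by linarith), ← pow_mul]
    calc μ.real bad ≤ ∑ z ∈ net, μ.real {ω | n * (a * (105 * θ * 4 ^ 4)) + L / a ≤
          |D (fun i => (z i : ℝ) / (r * n : ℕ)) ω|} := measureReal_biUnion_finset_le _ _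
      _ ≤ ∑ z ∈ net, 2 * Real.exp (-L) := Finset.sum_le_sum h1
      _ = net.card * (2 * Real.exp (-L)) := by rw [Finset.sum_const, nsmul_eq_mul]
      _ ≤ Real.exp (3 * r * Real.log n) * (2 * Real.exp (-L)) := by gcongr
      _ = 2 * Real.exp (-(r * Real.log n)) := by
        rw [mul_left_comm, ← Real.exp_add]; congr 2; rw [hLdef]; ring
      _ ≤ 2 * Real.exp (-Real.log n) := by
        gcongr
        exact le_mul_of_one_le_left hlog.le hrR
      _ = 2 / n := by rw [Real.exp_neg, Real.exp_log (by linarith)]; rfl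
  · intro ω hω u hu
    obtain ⟨z, hz, hzu⟩ := exists_gridPoint_near hN hu
    set w : Fin r → ℝ := fun i => (z i : ℝ) / (r * n : ℕ) with hw
    have huw : ∑ i, (u i - w i) ^ 2 ≤ (1 / (n : ℝ)) ^ 2 := by
      refine hzu.trans ?_
      push_cast
      rw [one_div, one_div, mul_inv, mul_pow, ← mul_assoc]
      have : (r : ℝ) * (r : ℝ)⁻¹ ^ 2 ≤ 1 := by
        rw [sq, ← mul_assoc, mul_inv_cancel₀ (by linarith), one_mul]
        exact inv_le_one_of_one_le₀ hrR
      exact mul_le_of_le_one_left (by positivity) this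
    have hw4 : ∑ i, w i ^ 2 ≤ 4 := by
      have h1 : ∑ i, w i ^ 2 ≤ ∑ i, (2 * u i ^ 2 + 2 * (u i - w i) ^ 2) :=
        Finset.sum_le_sum fun i _ => by nlinarith [sq_nonneg (2 * u i - w i)]
      rw [Finset.sum_add_distrib, ← Finset.mul_sum, ← Finset.mul_sum, hu] at h1
      have h2 : (1 / (n : ℝ)) ^ 2 ≤ 1 := by
        apply pow_le_one₀ (by positivity)
        rw [div_le_one (by linarith)]; linarith
      linarith
    have hzn : z ∈ net := Finset.mem_filter.2 ⟨hz, hw4⟩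
    have hD : |D w ω| ≤ 2 * √(n * (105 * θ * 4 ^ 4) * L) + L * (R * 4) ^ 2 := by
      by_contra hcon
      refine hω (Set.mem_iUnion₂.2 ⟨z, hzn, ?_⟩)
      exact hT.trans (not_le.1 hcon).le
    have hlip : ∀ k ω, |Y u k ω - Y w k ω| ≤ 15 * R ^ 2 * (1 / n) := fun k ω =>
      abs_truncatedQuartic_sub_le (by positivity) hu.le hw4 huw _
    have hYi : ∀ y : Fin r → ℝ, ∀ k, Integrable (Y y k) μ := fun y k =>
      (integrable_const ((R * ∑ i, y i ^ 2) ^ 2)).mono' (hYm y k).aestronglyMeasurable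
        (ae_of_all _ fun ω => abs_truncatedQuartic_le _ _ le_rfl)
    have h1 : |∑ k, Y u k ω - ∑ k, Y w k ω| ≤ 15 * R ^ 2 := by
      rw [← Finset.sum_sub_distrib]
      refine (Finset.abs_sum_le_sum_abs _ _).trans ((Finset.sum_le_sum fun k _ =>
        hlip k ω).trans (le_of_eq ?_))
      simp; field_simp
    have h2 : |∑ k, ∫ ω', Y u k ω' ∂μ - ∑ k, ∫ ω', Y w k ω' ∂μ| ≤ 15 * R ^ 2 := by
      rw [← Finset.sum_sub_distrib]
      refine (Finset.abs_sum_le_sum_abs _ _).trans ((Finset.sum_le_sum (g := fun _ =>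
        15 * R ^ 2 * (1 / (n : ℝ))) fun k _ => ?_).trans (le_of_eq ?_))
      · rw [← integral_sub (hYi u k) (hYi w k)]
        refine (abs_integral_le_integral_abs).trans ?_
        refine (integral_mono ((hYi u k).sub (hYi w k)).abs (integrable_const _)
          fun ω => hlip k ω).trans (by simp)
      · simp; field_simp
    have h3 := abs_le.1 h1
    have h4 := abs_le.1 h2
    have h5 := abs_le.1 hD
    change |∑ k, Y u k ω - ∑ k, ∫ ω', Y u k ω' ∂μ| ≤ _
    simp only [D] at h5
    exact abs_le.2 ⟨by linarith, by linarith⟩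

end Uniform

/-! ### Uniform deviation at the stated rate, without truncation -/

theorem deviation_bound_le_errorRate {r n : ℕ} {θ : ℝ} (hθ0 : 0 < θ) (hθ : θ ≤ 1 / 9) (hr : 0 < r)
    (hn : 3 ≤ n) :
    1 / (3 * θ * n) * (2 * √(n * (105 * θ * 4 ^ 4) * (4 * r * Real.log n)) +
      (4 * r * Real.log n) * (4 * (θ * r + 4 * Real.log n) * 4) ^ 2 +
      30 * (4 * (θ * r + 4 * Real.log n)) ^ 2 + (105 * θ + 1) / (2 * n)) ≤
    20000 * errorRate r n θ := by
  have hnR : (3 : ℝ) ≤ n := by exact_mod_cast hn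
  have hrR : (1 : ℝ) ≤ r := by exact_mod_cast hr
  have hl : 1 ≤ Real.log n := by
    rw [Real.le_log_iff_exp_le (by linarith)]
    exact Real.exp_one_lt_three.le.trans hnR
  set l := Real.log n
  have hn0 : (0 : ℝ) < n := by linarith
  have hr0 : (0 : ℝ) < r := by linarith
  have hl0 : 0 < l := by linarith
  set E := (θ * (r : ℝ) ^ 2 + l ^ 2 / θ) * ((r : ℝ) * l / n) with hE
  have hrl : 1 ≤ (r : ℝ) * l := one_le_mul_of_one_le_of_one_le hrR hl
  -- The constant works because `328² = 107584 ≥ 105 · 4⁴ · 4 = 107520`.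
  have h1 : √(n * (105 * θ * 4 ^ 4) * (4 * r * l)) ≤
      328 * (θ * n) * √((r : ℝ) ^ 2 * l / (θ * n)) := by
    rw [Real.sqrt_le_left (by positivity), mul_pow, Real.sq_sqrt (by positivity)]
    have : (328 * (θ * n)) ^ 2 * ((r : ℝ) ^ 2 * l / (θ * n)) =
        328 ^ 2 * (θ * n) * l * (r * r) := by field_simp
    rw [this]
    have : (r : ℝ) ≤ r * r := le_mul_of_one_le_left hr0.le hrR
    have : 328 ^ 2 * (θ * n) * l * r ≤ 328 ^ 2 * (θ * n) * l * (r * r) := by gcongr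
    have : 0 ≤ θ * n * l * r := by positivity
    linarith
  have h2 : (4 * (θ * r + 4 * l)) ^ 2 ≤ 512 * (θ * (θ * (r : ℝ) ^ 2 + l ^ 2 / θ)) := by
    have : θ * (θ * (r : ℝ) ^ 2 + l ^ 2 / θ) = (θ * r) ^ 2 + l ^ 2 := by field_simp
    rw [this]
    nlinarith [sq_nonneg (θ * r - 4 * l), sq_nonneg (θ * r)]
  set F := θ * (θ * (r : ℝ) ^ 2 + l ^ 2 / θ) with hF
  have hF1 : 1 ≤ F := by
    have : F = (θ * r) ^ 2 + l ^ 2 := by rw [hF]; field_simp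
    rw [this]; nlinarith [sq_nonneg (θ * r)]
  have hE3 : 1 / (3 * θ * n) * (F * (r * l)) = E / 3 := by rw [hE, hF]; field_simp
  have h3 : (4 * r * l) * (4 * (θ * r + 4 * l) * 4) ^ 2 ≤ 32768 * (F * (r * l)) := by
    have : (4 * r * l) * (4 * (θ * r + 4 * l) * 4) ^ 2 =
      64 * (r * l) * (4 * (θ * r + 4 * l)) ^ 2 := by ring
    rw [this]
    have := mul_le_mul_of_nonneg_left h2 (by positivity : 0 ≤ 64 * (r * l))
    linarith
  have hFrl : F ≤ F * (r * l) := le_mul_of_one_le_right (by linarith) hrl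
  have h4 : (105 * θ + 1) / (2 * n) ≤ 10 * (F * (r * l)) := by
    have : (105 * θ + 1) / (2 * n) ≤ 10 := by
      rw [div_le_iff₀ (by linarith)]; linarith
    linarith
  have hc : 0 ≤ 1 / (3 * θ * n) := by positivity
  -- Here `48138 = 32768 + 30 · 512 + 10`, collecting the Bernstein range term, the grid error and
  -- the bias.
  calc _ ≤ 1 / (3 * θ * n) * (2 * (328 * (θ * n) * √((r : ℝ) ^ 2 * l / (θ * n))) +
        48138 * (F * (r * l))) := by
        refine mul_le_mul_of_nonneg_left ?_ hc
        linarith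
    _ = 656 / 3 * √((r : ℝ) ^ 2 * l / (θ * n)) + 48138 * (1 / (3 * θ * n) * (F * (r * l))) := by
        field_simp
        ring
    _ ≤ 20000 * (√((r : ℝ) ^ 2 * l / (θ * n)) + E) := by
        rw [hE3]
        have : 0 ≤ √((r : ℝ) ^ 2 * l / (θ * n)) := Real.sqrt_nonneg _
        have : 0 ≤ E := by positivity
        linarith
    _ = _ := by rw [errorRate]

theorem populationQuartic_smul {ι : Type*} [Fintype ι] (θ s : ℝ) (a : ι → ℝ) :
    populationQuartic θ (s • a) = s ^ 4 * populationQuartic θ a := by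
  simp only [populationQuartic, Pi.smul_apply, smul_eq_mul, mul_pow, ← Finset.mul_sum]
  ring

theorem exists_uniform_quartic_deviation {Ω : Type*} [MeasurableSpace Ω] {μ : Measure Ω}
    [IsProbabilityMeasure μ] {θ : ℝ} {r n : ℕ} {X : Fin n → Fin r → Ω → ℝ} (hθ0 : 0 < θ)
    (hθ : θ ≤ 1 / 9) (hr : 0 < r) (hn : 3 ≤ n) (hrn : r ≤ n)
    (hX : ∀ k i, IsSparseGaussian μ θ (X k i)) (hind : ∀ k, iIndepFun (X k) μ)
    (hcol : iIndepFun (fun k ω i => X k i ω) μ) :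
    ∃ bad : Set Ω, μ.real bad ≤ 3 / n ∧ ∀ ω ∉ bad, ∀ a : Fin r → ℝ,
      |1 / (3 * θ * n) * ∑ k, ((fun i => X k i ω) ⬝ᵥ a) ^ 4 - populationQuartic θ a| ≤
        20000 * errorRate r n θ * (∑ i, a i ^ 2) ^ 2 := by
  have hnR : (3 : ℝ) ≤ n := by exact_mod_cast hn
  have hn0 : (0 : ℝ) < n := by linarith
  have hlog : 0 < Real.log n := Real.log_pos (by linarith)
  -- Chosen so that each column exceeds `R` with probability at most `n⁻⁴`. This pays for a union
  -- over the `n` columns and for the bias with weight `a = n⁻²`.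
  set R : ℝ := 4 * (θ * r + 4 * Real.log n) with hR
  have hR0 : 0 < R := by positivity
  have htail : Real.exp (θ * r / 2 - R / 4) ≤ ((n : ℝ) ^ 4)⁻¹ := by
    have : ((n : ℝ) ^ 4)⁻¹ = Real.exp (-(4 * Real.log n)) := by
      rw [Real.exp_neg, show 4 * Real.log n = ((4 : ℕ) : ℝ) * Real.log n by norm_num,
        Real.exp_nat_mul, Real.exp_log hn0]
    rw [this]
    refine Real.exp_le_exp.2 ?_
    have : 0 ≤ θ * r := by positivity
    rw [hR]; linarith
  obtain ⟨bad₁, hbad₁, hdev⟩ := exists_uniform_truncatedQuartic_deviation hθ0 (by linarith) hr hn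
    hrn hX hind hcol hR0
  refine ⟨bad₁ ∪ ⋃ k, {ω | R ≤ ∑ i, X k i ω ^ 2}, ?_, fun ω hω => ?_⟩
  · have h1 : μ.real (⋃ k, {ω | R ≤ ∑ i, X k i ω ^ 2}) ≤ 1 / n := by
      calc _ ≤ ∑ k, μ.real {ω | R ≤ ∑ i, X k i ω ^ 2} := measureReal_iUnion_fintype_le _
        _ ≤ ∑ _k : Fin n, ((n : ℝ) ^ 4)⁻¹ := Finset.sum_le_sum fun k _ =>
          (measure_sum_sq_ge_le hθ0.le (hX k) (hind k) R).trans htail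
        _ = 1 / n * ((n : ℝ) ^ 2)⁻¹ := by simp; field_simp
        _ ≤ 1 / n := mul_le_of_le_one_right (by positivity)
          (inv_le_one_of_one_le₀ (one_le_pow₀ (by linarith)))
    calc _ ≤ _ := measureReal_union_le _ _
      _ ≤ 2 / n + 1 / n := add_le_add hbad₁ h1
      _ = _ := by ring
  · rw [Set.mem_union, not_or, Set.mem_iUnion, not_exists] at hω
    obtain ⟨hω₁, hω₂⟩ := hω
    have hunit : ∀ u : Fin r → ℝ, ∑ i, u i ^ 2 = 1 →
        |1 / (3 * θ * n) * ∑ k, ((fun i => X k i ω) ⬝ᵥ u) ^ 4 - populationQuartic θ u| ≤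
          20000 * errorRate r n θ := by
      intro u hu
      have h1 := hdev ω hω₁ u hu
      have h2 : ∑ k, truncatedQuartic R u (fun i => X k i ω) =
          ∑ k, ((fun i => X k i ω) ⬝ᵥ u) ^ 4 := by
        refine Finset.sum_congr rfl fun k _ => ?_
        rw [truncatedQuartic, if_pos (not_le.1 (hω₂ k)).le]
      rw [h2] at h1
      have h3 : |∑ k, ∫ ω', truncatedQuartic R u (fun i => X k i ω') ∂μ -
          n * (3 * θ * populationQuartic θ u)| ≤ (105 * θ + 1) / (2 * n) := by
        have e : (n : ℝ) * (3 * θ * populationQuartic θ u) =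
            ∑ _k : Fin n, 3 * θ * populationQuartic θ u := by simp
        rw [e, ← Finset.sum_sub_distrib]
        refine (Finset.abs_sum_le_sum_abs _ _).trans ((Finset.sum_le_sum (g := fun _ =>
          (105 * θ + 1) / (2 * (n : ℝ) ^ 2)) fun k _ => ?_).trans (le_of_eq ?_))
        · refine (abs_integral_truncatedQuartic_sub_le hθ0.le (by linarith) (hX k) (hind k) R hu
            (a := ((n : ℝ) ^ 2)⁻¹) (by positivity)).trans ?_
          rw [inv_inv]
          calc _ ≤ (((n : ℝ) ^ 2)⁻¹ * (105 * θ) + (n : ℝ) ^ 2 * ((n : ℝ) ^ 4)⁻¹) / 2 := by gcongr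
            _ = _ := by field_simp
        · simp; field_simp
      have h4 : 1 / (3 * θ * n) * ∑ k, ((fun i => X k i ω) ⬝ᵥ u) ^ 4 - populationQuartic θ u =
          1 / (3 * θ * n) * (∑ k, ((fun i => X k i ω) ⬝ᵥ u) ^ 4 -
            n * (3 * θ * populationQuartic θ u)) := by field_simp
      have hc : 0 ≤ 1 / (3 * θ * n) := by positivity
      rw [h4, abs_mul, abs_of_nonneg hc]
      refine (mul_le_mul_of_nonneg_left ?_ hc).trans (deviation_bound_le_errorRate hθ0 hθ hr hn)
      refine (abs_sub_le _ (∑ k, ∫ ω', truncatedQuartic R u (fun i => X k i ω') ∂μ) _).trans ?_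
      exact add_le_add h1 h3
    intro a
    set s := √(∑ i, a i ^ 2) with hs
    have hs0 : 0 ≤ ∑ i, a i ^ 2 := Finset.sum_nonneg fun i _ => sq_nonneg _
    have hs2 : s ^ 2 = ∑ i, a i ^ 2 := Real.sq_sqrt hs0
    rcases hs0.eq_or_lt with h0 | hpos
    · have ha : a = 0 := by
        ext i
        have := (Finset.sum_eq_zero_iff_of_nonneg (fun i _ => sq_nonneg (a i))).1 h0.symm i
          (Finset.mem_univ i)
        simpa using this
      simp [ha, populationQuartic]
    · have hsp : 0 < s := Real.sqrt_pos.2 hpos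
      have h1 := hunit (s⁻¹ • a) (by
        simp only [Pi.smul_apply, smul_eq_mul, mul_pow, ← Finset.mul_sum]
        rw [← hs2]; field_simp)
      have h2 : a = s • (s⁻¹ • a) := by rw [smul_smul, mul_inv_cancel₀ hsp.ne', one_smul]
      set b := s⁻¹ • a
      rw [← hs2, h2, populationQuartic_smul]
      simp only [dotProduct_smul, smul_eq_mul, mul_pow, ← Finset.mul_sum]
      have h3 : ∀ y z : ℝ, 1 / (3 * θ * n) * (s ^ 4 * y) - s ^ 4 * z =
          s ^ 4 * (1 / (3 * θ * n) * y - z) := fun y z => by ring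
      rw [h3, abs_mul, abs_of_nonneg (by positivity : 0 ≤ s ^ 4)]
      calc _ ≤ s ^ 4 * (20000 * errorRate r n θ) := by gcongr
        _ = _ := by ring

/-! ### Consequences of the Bernoulli-Gaussian model -/

section Model

variable {Ω : Type*} [MeasurableSpace Ω] {μ : Measure Ω} [IsProbabilityMeasure μ] {r n : ℕ}
  {θ : unitInterval} {σ : ℝ} {X : Ω → Matrix (Fin r) (Fin n) ℝ}

theorem IsBernoulliGaussian.isSparseGaussian_div (hσ : 0 < σ) (hX : IsBernoulliGaussian μ θ σ X) :
    (∀ (k : Fin n) (i : Fin r), IsSparseGaussian μ θ fun ω => X ω i k / σ) ∧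
    (∀ k : Fin n, iIndepFun (fun (i : Fin r) ω => X ω i k / σ) μ) ∧
    iIndepFun (fun (k : Fin n) ω (i : Fin r) => X ω i k / σ) μ := by
  obtain ⟨B, Z, hB, hZ, hind, hXBZ⟩ := hX
  have hZσ : ∀ i k, HasLaw (fun ω => Z i k ω / σ) (gaussianReal 0 1) μ := fun i k => by
    have h := gaussianReal_div_const (hZ i k) σ
    convert h using 2
    · simp
    · ext
      simp only [NNReal.coe_one, NNReal.coe_div, Real.coe_toNNReal _ (sq_nonneg σ), NNReal.coe_mk]
      field_simp
  let f : (Fin r × Fin n) ⊕ (Fin r × Fin n) → Ω → ℝ := fun k =>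
    Sum.elim (fun e => B e.1 e.2) (fun e => Z e.1 e.2) k
  have hf : iIndepFun f μ := hind
  have hfm : ∀ k, AEMeasurable (f k) μ := by
    rintro (e | e)
    · exact (hB e.1 e.2).aemeasurable
    · exact (hZ e.1 e.2).aemeasurable
  have e : ∀ i k ω, X ω i k / σ = B i k ω * (Z i k ω / σ) := fun i k ω => by
    rw [hXBZ, mul_div_assoc]
  refine ⟨fun k i => ⟨?_, fun g hg hgi => ?_⟩, fun k => ?_, ?_⟩
  · simp only [e]
    exact (hB i k).aemeasurable.mul (hZσ i k).aemeasurable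
  · simp only [e]
    have h1 : IndepFun (B i k) (Z i k) μ :=
      hf.indepFun (i := Sum.inl (i, k)) (j := Sum.inr (i, k)) (by simp)
    have h2 : IndepFun (B i k) (fun ω => Z i k ω / σ) μ :=
      h1.comp (φ := id) (ψ := fun z => z / σ) measurable_id (by fun_prop)
    exact integral_comp_bernoulli_mul_gaussian (hB i k) (hZσ i k) h2 hg hgi
  -- The Boolean selects `B` (true) or `Z` (false). Reindexing along an injection keeps
  -- independence, and currying groups the variables entry by entry; below, the same device groups
  -- them by columns.
  · let g : Fin r × Bool → (Fin r × Fin n) ⊕ (Fin r × Fin n) := fun e =>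
      if e.2 then Sum.inl (e.1, k) else Sum.inr (e.1, k)
    have hg : g.Injective := by
      rintro ⟨i, b⟩ ⟨i', b'⟩ h
      cases b <;> cases b' <;> simp [g] at h ⊢ <;> exact h
    have h1 := iIndepFun_curry (fun e => hfm (g e)) (hf.precomp hg)
    have h2 := h1.comp (fun _ y => y true * (y false / σ)) fun _ => by fun_prop
    simp only [e]
    exact h2
  · let g : Fin n × (Fin r × Bool) → (Fin r × Fin n) ⊕ (Fin r × Fin n) := fun e =>
      if e.2.2 then Sum.inl (e.2.1, e.1) else Sum.inr (e.2.1, e.1)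
    have hg : g.Injective := by
      rintro ⟨k, i, b⟩ ⟨k', i', b'⟩ h
      cases b <;> cases b' <;> simp [g] at h ⊢ <;> exact h.symm
    have h1 := iIndepFun_curry (fun e => hfm (g e)) (hf.precomp hg)
    have h2 := h1.comp (fun _ y i => y (i, true) * (y (i, false) / σ)) fun _ => by fun_prop
    simp only [e]
    exact h2

end Model

/-! ### Sample size and conclusion -/

/-- The first entry of the maximum controls the square-root term and the `θ r²` term, the second the
`log² n / θ` term. Each is at most `cs / 4000000`, and `3 · 20000 / 4000000 < 1/45`. The constant is
squared in the hypothesis because of the square root. -/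
theorem errorRate_le_of_sampleSize {r n : ℕ} {θ cs : ℝ} (hr : 0 < r) (hn : 3 ≤ n) (hθ0 : 0 < θ)
    (hθ : θ ≤ 1 / 9) (hcs0 : 0 < cs) (hcs : cs ≤ 1 / 4)
    (hsize : (4000000 : ℝ) ^ 2 * max ((r : ℝ) ^ 2 / cs) (Real.log n ^ 2) *
      ((r : ℝ) * Real.log n / (θ * cs)) ≤ n) :
    r ≤ n ∧ 20000 * errorRate r n θ ≤ cs / 45 := by
  have hnR : (3 : ℝ) ≤ n := by exact_mod_cast hn
  have hrR : (1 : ℝ) ≤ r := by exact_mod_cast hr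
  have hl : 1 ≤ Real.log n := by
    rw [Real.le_log_iff_exp_le (by linarith)]
    exact Real.exp_one_lt_three.le.trans hnR
  set l := Real.log n
  have hn0 : (0 : ℝ) < n := by linarith
  have hr0 : (0 : ℝ) < r := by linarith
  have hl0 : 0 < l := by linarith
  have h1 : (4000000 : ℝ) ^ 2 * ((r : ℝ) ^ 3 * l) ≤ n * (θ * cs ^ 2) := by
    have : (4000000 : ℝ) ^ 2 * ((r : ℝ) ^ 2 / cs) * ((r : ℝ) * l / (θ * cs)) ≤ n := by
      refine le_trans ?_ hsize
      gcongr
      exact le_max_left _ _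
    have e : (4000000 : ℝ) ^ 2 * ((r : ℝ) ^ 2 / cs) * ((r : ℝ) * l / (θ * cs)) =
      (4000000 : ℝ) ^ 2 * ((r : ℝ) ^ 3 * l) / (θ * cs ^ 2) := by field_simp
    rwa [e, div_le_iff₀ (by positivity)] at this
  have h2 : (4000000 : ℝ) ^ 2 * (r * l ^ 3) ≤ n * (θ * cs) := by
    have : (4000000 : ℝ) ^ 2 * l ^ 2 * ((r : ℝ) * l / (θ * cs)) ≤ n := by
      refine le_trans ?_ hsize
      gcongr
      exact le_max_right _ _
    have e : (4000000 : ℝ) ^ 2 * l ^ 2 * ((r : ℝ) * l / (θ * cs)) =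
      (4000000 : ℝ) ^ 2 * (r * l ^ 3) / (θ * cs) := by field_simp
    rwa [e, div_le_iff₀ (by positivity)] at this
  have hr3 : (r : ℝ) ^ 2 ≤ r ^ 3 := pow_le_pow_right₀ hrR (by norm_num)
  have hr2 : (r : ℝ) ≤ r ^ 2 := le_self_pow₀ hrR (by norm_num)
  have hθcs : θ * cs ^ 2 ≤ 1 := by nlinarith [mul_pos hcs0 hcs0]
  constructor
  · have h3 : (r : ℝ) ≤ r ^ 3 * l := by nlinarith [pow_pos hr0 3]
    have h4 : n * (θ * cs ^ 2) ≤ n := mul_le_of_le_one_right hn0.le hθcs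
    have : (r : ℝ) ≤ n := by nlinarith
    exact_mod_cast this
  · have hA : √((r : ℝ) ^ 2 * l / (θ * n)) ≤ cs / 4000000 := by
      rw [Real.sqrt_le_left (by positivity), div_pow, div_le_div_iff₀ (by positivity)
        (by positivity)]
      have := mul_le_mul_of_nonneg_right hr3 hl0.le
      linarith
    have hB : (θ * (r : ℝ) ^ 2) * ((r : ℝ) * l / n) ≤ cs / 4000000 := by
      rw [mul_div_assoc', div_le_div_iff₀ hn0 (by positivity)]
      have h5 : θ * (n * (θ * cs ^ 2)) ≤ cs * n := by
        have : θ * (θ * cs ^ 2) ≤ cs := by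
          have h6 : θ * (θ * cs ^ 2) ≤ 1 * (1 * (cs * 1)) := by
            rw [sq]; gcongr <;> linarith
          linarith
        nlinarith
      have := mul_le_mul_of_nonneg_left h1 hθ0.le
      have h7 : 0 ≤ θ * (r ^ 3 * l) := by positivity
      nlinarith
    have hC : (l ^ 2 / θ) * ((r : ℝ) * l / n) ≤ cs / 4000000 := by
      rw [div_mul_div_comm, div_le_div_iff₀ (by positivity) (by positivity)]
      have h7 : 0 ≤ r * l ^ 3 := by positivity
      nlinarith
    have : errorRate r n θ = √((r : ℝ) ^ 2 * l / (θ * n)) +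
        ((θ * (r : ℝ) ^ 2) * ((r : ℝ) * l / n) + (l ^ 2 / θ) * ((r : ℝ) * l / n)) := by
      rw [errorRate]; ring
    rw [this]
    linarith

end SparseDecomposition

theorem mainTheorem3 :
    ∃ C c c' K : ℝ, 0 < C ∧ 0 < c ∧ 0 < c' ∧ 0 < K ∧
      ∀ (p r n : ℕ) (hr : 0 < r) (_hn : 0 < n)
        (A : Matrix (Fin p) (Fin r) ℝ) (_hA : Aᵀ * A = 1)
        (θ : unitInterval) (_hθ0 : 0 < (θ : ℝ)) (_hθ : (θ : ℝ) ≤ 1 / 9)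
        (σ : ℝ) (_hσ : 0 < σ)
        (cs : ℝ) (_hcs0 : 0 < cs) (_hcs : cs ≤ 1 / 4)
        (_hsize : C * max ((r : ℝ) ^ 2 / cs) (Real.log n ^ 2) *
          ((r : ℝ) * Real.log n / ((θ : ℝ) * cs)) ≤ (n : ℝ))
        (Ω : Type*) [MeasurableSpace Ω] (μ : Measure Ω) [IsProbabilityMeasure μ]
        (X : Ω → Matrix (Fin r) (Fin n) ℝ)
        (_hX : SparseDecomposition.IsBernoulliGaussian μ θ σ X),
        ∃ E : Set Ω, MeasurableSet E ∧ 1 - c * (n : ℝ) ^ (-c') ≤ μ.real E ∧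
          ∀ ω ∈ E, ∀ q : EuclideanSpace ℝ (Fin p),
            SparseDecomposition.IsLocalSolution (θ : ℝ) σ (A * X ω) q →
            q ∉ SparseDecomposition.nullRegion A cs →
            ∃ P : Matrix (Fin r) (Fin r) ℝ, SparseDecomposition.IsSignedPermutation P ∧
              ‖q - WithLp.toLp 2 ((A * P).col ⟨0, hr⟩)‖ ^ 2 ≤
                K * (Real.sqrt ((r : ℝ) ^ 2 * Real.log n / ((θ : ℝ) * n)) +
                  ((θ : ℝ) * (r : ℝ) ^ 2 + Real.log n ^ 2 / (θ : ℝ)) *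
                    ((r : ℝ) * Real.log n / n)) := by
  refine ⟨4000000 ^ 2, 3, 1, 46 * 20000, by norm_num, by norm_num, by norm_num, by norm_num, ?_⟩
  intro p r n hr hn A hA θ hθ0 hθ σ hσ cs hcs0 hcs hsize Ω _ μ _ X hX
  have hpow : (3 : ℝ) * (n : ℝ) ^ (-1 : ℝ) = 3 / n := by
    rw [Real.rpow_neg_one]; rfl
  rw [hpow]
  have hn0 : (0 : ℝ) < n := by exact_mod_cast hn
  -- For `n < 3` the asserted probability `1 - 3 / n` is not positive, so the empty event suffices.
  rcases lt_or_ge n 3 with hlt | hn3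
  · refine ⟨∅, MeasurableSet.empty, ?_, by simp⟩
    have : (1 : ℝ) ≤ 3 / n := by
      rw [le_div_iff₀ hn0, one_mul]
      exact_mod_cast hlt.le
    simpa using this
  · obtain ⟨hrn, herr⟩ := SparseDecomposition.errorRate_le_of_sampleSize hr hn3 hθ0 hθ hcs0 hcs hsize
    obtain ⟨hS, hind, hcol⟩ := hX.isSparseGaussian_div hσ
    obtain ⟨bad, hbad, hdev⟩ :=
      SparseDecomposition.exists_uniform_quartic_deviation hθ0 hθ hr hn3 hrn hS hind hcol
    -- The variables are only almost everywhere measurable, so the bad set is replaced by a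
    -- measurable hull of equal measure.
    refine ⟨(toMeasurable μ bad)ᶜ, (measurableSet_toMeasurable μ bad).compl, ?_, ?_⟩
    · rw [probReal_compl_eq_one_sub (measurableSet_toMeasurable μ bad)]
      have : μ.real (toMeasurable μ bad) = μ.real bad := by
        simp only [measureReal_def, measure_toMeasurable]
      rw [this]
      linarith
    · intro ω hω q hq hqcs
      obtain ⟨P, hP, hPq⟩ :=
        SparseDecomposition.exists_signedPermutation_near_of_isLocalSolution hr hn hA hθ0 hθ hσ hcs
          herr (hdev ω fun h => hω (subset_toMeasurable μ bad h)) hq hqcs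
      refine ⟨P, hP, hPq.trans (le_of_eq ?_)⟩
      rw [SparseDecomposition.errorRate]
      ring
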